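/- **Setting.** A schema consists of plaintext types (among them $\mathit{Boolean}$ and $\mathit{HashDom}$, the latter with a finite nonempty domain), finitely many encrypted types $e$, each with a nonempty domain and its own symmetric encryption scheme $\mathcal E_e$ with an independent uniform key, and a set $\mathcal R$ of rules $f(T_1,\dots,T_n)\to\langle T'_1,\dots,T'_m\rangle$, including rules of the special forms $\mathit{equal}(T,T)\to\mathit{Boolean}$ (the equality predicate) and $\mathit{hash}(T)\to\mathit{HashDom}$ (a secret random function, one for each type $T$). The information flow graph has the types as vertices and an edge $T\to T'$ labelled $f(i,j)$ for every rule with function $f$, $i$-th input type $T$ and $j$-th output type $T'$; paths are walks. An encrypted type $D$ is *Deterministic* if (1) every path from $D$ to $\mathit{Boolean}$ has the form $D\xrightarrow{f_1(1,1)}T_1\to\cdots\xrightarrow{f_k(1,1)}T_k\xrightarrow{\mathit{equal}}\mathit{Boolean}$, where the $f_i$ are injective and the last edge belongs to the rule $\mathit{equal}(T_k,T_k)\to\mathit{Boolean}$; (2) every path from $D$ to $\mathit{HashDom}$ has the same form with the last edge given by $\mathit{hash}(T_k)\to\mathit{HashDom}$; (3) for each $T_i$ in (1) and (2) there is a unique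 path from $D$ to $T_i$; (4) there is no path from $D$ to any other plaintext type. It is *strict* if every rule that outputs an encrypted type lying on a path from $D$ to $\mathit{Boolean}$ or $\mathit{HashDom}$ ($D$ included) has an input type reachable from $D$. **Experiment.** For values $d=(d_i)_{i\in I}$ of type $D$, the adversary may adaptively: read encryptions of the $d_i$; obtain encryptions of chosen values of every encrypted type that does not lie on a path from $D$ to $\mathit{Boolean}$ or $\mathit{HashDom}$; and call the trusted machine with any rule of $\mathcal R$ and any input. The machine decrypts the encrypted inputs (and rejects if a decryption fails), evaluates the function, and returns the outputs, those of encrypted types being encrypted. Finally the adversary outputs a bit. Two such systems are called *indistinguishable* if there are black-box reductions, independent of the adversary, which run the adversary $A$ once and satisfy $$|\Pr[A=1\text{ in the first}]-\Pr[A=1\text{ in the second}]|\le\sum_{b\in\{0,1\}}\sum_e\bigl(\mathrm{Adv}^{\text{ind-cpa}}_{\mathcal E_e}(B_{b,e}^A)+\mathrm{Adv}^{\text{int-ctxt}}_{\mathcal E_e}(F_{b,e}^A)\bigr),$$ where per query of $A$ each $B_{b,e}$ makes at most $a$ and each $F_{b,e}$ at most $2a$ queries, $a\ge1$ being a bound on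 the numbers of inputs and of outputs of the rules. **Theorem.** Let $D$ be a strict Deterministic type. Then values of type $D$ leak what deterministic encryption leaks, namely only the equality among them: 1. If $d$ and $d'$ have the same equality pattern ($d_i=d_j\iff d'_i=d'_j$ for all $i,j$), then the systems with values $d$ and $d'$ are indistinguishable. 2. For every deterministic encryption method $\mathrm{enc}$ on the domain of $D$ (that is, $\mathrm{enc}_k(x)=\mathrm{enc}_k(y)\iff x=y$) there is a simulator which, given only the ciphertexts $(\mathrm{enc}_k(d_i))_{i}$, is indistinguishable from the system with values $d$, for all $k$ and $d$. 3. Conversely, if there is a path from $D$ to $\mathit{Boolean}$, then for all $i,j$ there is an adversary, with a bounded number of queries and independent of $d$, that decides with probability $1$ whether $d_i=d_j$. If there is a path from $D$ to $\mathit{HashDom}$, there is one that answers "equal" with probability $1$ if $d_i=d_j$ and "different" with probability $1-1/|\mathit{HashDom}|$ if $d_i\ne d_j$. -/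

import Mathlib

noncomputable section

open scoped Classical

namespace EncDB

/-! ## Oracle programs, oracle systems, black-box emulation -/

/-- An oracle interface: queries and, for every query, the type of its answers. -/
structure Interface where
  Q : Type
  R : Q → Type

/-- A probabilistic program with oracle access: it returns a value, asks the oracle, or samples. -/
inductive Prog (I : Interface) (α : Type) : Type 1
  | ret (a : α) : Prog I α
  | ask (q : I.Q) (k : I.R q → Prog I α) : Prog I α
  | sample {β : Type} (p : PMF β) (k : β → Prog I α) : Prog I α

/-- A stateful probabilistic oracle. -/
structure System (I : Interface) where
  State : Type
  init : PMF State
  step : State → (q : I.Q) → PMF (I.R q × State)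

namespace Prog

/-- Sequential composition. -/
def bind {I : Interface} {α β : Type} : Prog I α → (α → Prog I β) → Prog I β
  | ret a, f => f a
  | ask q k, f => ask q fun r => (k r).bind f
  | sample p k, f => sample p fun b => (k b).bind f

/-- On no branch does the program ask more than `n` queries. -/
def AtMost {I : Interface} {α : Type} : Prog I α → ℕ → Prop
  | ret _, _ => True
  | ask _ _, 0 => False
  | ask _ k, n + 1 => ∀ r, (k r).AtMost n
  | sample _ k, n => ∀ b, (k b).AtMost n

/-- Running a program against an oracle, from a given oracle state. -/
def runFrom {I : Interface} {α : Type} (O : System I) : Prog I α → O.State → PMF (α × O.State)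
  | ret a, s => PMF.pure (a, s)
  | ask q k, s => (O.step s q).bind fun x => (k x.1).runFrom O x.2
  | sample p k, s => p.bind fun b => (k b).runFrom O s

/-- The joint distribution of the output and of the final oracle state. -/
def run {I : Interface} {α : Type} (O : System I) (A : Prog I α) : PMF (α × O.State) :=
  O.init.bind (A.runFrom O)

/-- The probability that the program outputs `a`. -/
def prob {I : Interface} {α : Type} (O : System I) (A : Prog I α) (a : α) : ℝ :=
  (((A.run O).map Prod.fst) a).toReal

end Prog

/-- An emulator answers queries of the interface `I` with the help of an oracle for `J`. -/
structure Emulator (I J : Interface) where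
  State : Type
  init : PMF State
  step : State → (q : I.Q) → Prog J (I.R q × State)

namespace Emulator

/-- Each query is answered with at most `n` queries to the underlying oracle. -/
def Cost {I J : Interface} (M : Emulator I J) (n : ℕ) : Prop :=
  ∀ s q, (M.step s q).AtMost n

/-- Running `A` once, all its queries being answered by the emulator (from a given state). -/
def applyFrom {I J : Interface} {α : Type} (M : Emulator I J) : Prog I α → M.State → Prog J α
  | .ret a, _ => .ret a
  | .ask q k, s => (M.step s q).bind fun x => applyFrom M (k x.1) x.2
  | .sample p k, s => .sample p fun b => applyFrom M (k b) s

/-- The program that runs `A` once as a black box on top of the emulator. -/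
def apply {I J : Interface} {α : Type} (M : Emulator I J) (A : Prog I α) : Prog J α :=
  .sample M.init (M.applyFrom A)

end Emulator

/-! ## Encryption -/

/-- A (probabilistic) symmetric encryption scheme with message space `M`;
keys are drawn uniformly from a finite key space. -/
structure SymEnc (M : Type) where
  Key : Type
  Cipher : Type
  keyFintype : Fintype Key
  keyNonempty : Nonempty Key
  enc : Key → M → PMF Cipher
  dec : Key → Cipher → Option M
  correct : ∀ k m, ∀ c ∈ (enc k m).support, dec k c = some m

attribute [instance] SymEnc.keyFintype SymEnc.keyNonempty

/-- Deterministic encryption: `enc k x = enc k y ↔ x = y`. -/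
structure DetEnc (M : Type) where
  Key : Type
  Cipher : Type
  enc : Key → M → Cipher
  enc_eq_iff : ∀ k x y, enc k x = enc k y ↔ x = y

namespace SymEnc

/-- Left-or-right queries. -/
def cpaI {M : Type} (𝓔 : SymEnc M) : Interface where
  Q := M × M
  R := fun _ => 𝓔.Cipher

/-- The left-or-right oracle of the chosen-plaintext experiment. -/
def cpaSystem {M : Type} (𝓔 : SymEnc M) (b : Bool) : System 𝓔.cpaI where
  State := 𝓔.Key
  init := PMF.uniformOfFintype 𝓔.Key
  step := fun k q => (𝓔.enc k (if b then q.2 else q.1)).map fun c => (c, k)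

/-- The IND-CPA advantage of `B`. -/
def cpaAdv {M : Type} (𝓔 : SymEnc M) (B : Prog 𝓔.cpaI Bool) : ℝ :=
  |B.prob (𝓔.cpaSystem true) true - B.prob (𝓔.cpaSystem false) true|

/-- Encryption queries `inl m` and verification queries `inr c`. -/
def ctxtI {M : Type} (𝓔 : SymEnc M) : Interface where
  Q := M ⊕ 𝓔.Cipher
  R := fun q => match q with
    | .inl _ => 𝓔.Cipher
    | .inr _ => Bool

/-- The ciphertext-integrity experiment. The state holds the key, the ciphertexts issued so far,
and whether a valid ciphertext that was not issued has been submitted. -/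
def ctxtSystem {M : Type} (𝓔 : SymEnc M) : System 𝓔.ctxtI where
  State := 𝓔.Key × List 𝓔.Cipher × Bool
  init := (PMF.uniformOfFintype 𝓔.Key).map fun k => (k, [], false)
  step := fun s q => match q with
    | .inl m => (𝓔.enc s.1 m).map fun c => (c, (s.1, c :: s.2.1, s.2.2))
    | .inr c => PMF.pure ((𝓔.dec s.1 c).isSome,
        (s.1, s.2.1, s.2.2 || ((𝓔.dec s.1 c).isSome && decide (c ∉ s.2.1))))

/-- The INT-CTXT advantage of `F`: the probability that it submits a forgery. -/
def ctxtAdv {M α : Type} (𝓔 : SymEnc M) (F : Prog 𝓔.ctxtI α) : ℝ :=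
  (((F.run 𝓔.ctxtSystem).map fun x => x.2.2.2) true).toReal

end SymEnc

/-! ## Types, rules, schemas -/

/-- Types: the plaintext types `boolean` and `hashDom`, the other plaintext types,
and the encrypted types. -/
inductive Ty (P E : Type) : Type
  | boolean : Ty P E
  | hashDom : Ty P E
  | plain (p : P) : Ty P E
  | enc (e : E) : Ty P E

/-- Types together with their domains. -/
structure TypeSystem where
  P : Type
  E : Type
  encFintype : Fintype E
  domP : P → Type
  domE : E → Type
  HashVal : Type
  domP_nonempty : ∀ p, Nonempty (domP p)
  domE_nonempty : ∀ e, Nonempty (domE e)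
  hashFintype : Fintype HashVal
  hashNonempty : Nonempty HashVal

attribute [instance] TypeSystem.encFintype TypeSystem.domP_nonempty TypeSystem.domE_nonempty
  TypeSystem.hashFintype TypeSystem.hashNonempty

/-- The domain of a type; `boolean` is three-valued (`none` is SQL's `unknown`). -/
def TypeSystem.Dom (S : TypeSystem) : Ty S.P S.E → Type
  | .boolean => Option Bool
  | .hashDom => S.HashVal
  | .plain p => S.domP p
  | .enc e => S.domE e

/-- Rules `f (T₁, …, Tₙ) → ⟨T'₁, …, T'ₘ⟩`, with `equal (T, T) → Boolean` and
`hash (T) → HashDom` singled out. -/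
inductive Rule (S : TypeSystem) : Type
  | fn (n m : ℕ) (inp : Fin n → Ty S.P S.E) (out : Fin m → Ty S.P S.E)
      (f : (∀ i, S.Dom (inp i)) → ∀ j, S.Dom (out j)) : Rule S
  | equal (T : Ty S.P S.E) : Rule S
  | hash (T : Ty S.P S.E) : Rule S

namespace Rule

variable {S : TypeSystem}

/-- Number of inputs. -/
def nIn : Rule S → ℕ
  | fn n _ _ _ _ => n
  | equal _ => 2
  | hash _ => 1

/-- Number of outputs. -/
def nOut : Rule S → ℕ
  | fn _ m _ _ _ => m
  | equal _ => 1
  | hash _ => 1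

/-- Input types. -/
def inp : (r : Rule S) → Fin r.nIn → Ty S.P S.E
  | fn _ _ inp _ _ => inp
  | equal T => fun _ => T
  | hash T => fun _ => T

/-- Output types. -/
def out : (r : Rule S) → Fin r.nOut → Ty S.P S.E
  | fn _ _ _ out _ => out
  | equal _ => fun _ => .boolean
  | hash _ => fun _ => .hashDom

/-- The first output of the rule's function is an injective function of its input. -/
def IsInjective : Rule S → Prop
  | fn _ m _ _ f => ∃ h : 0 < m, Function.Injective fun x => f x ⟨0, h⟩
  | equal _ => False
  | hash _ => False

end Rule

/-- A schema: types, an encryption scheme for each encrypted type, and the rules. -/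
structure Schema extends TypeSystem where
  scheme : ∀ e : E, SymEnc (domE e)
  rules : Set (Rule toTypeSystem)

namespace Schema

/-! ## The information flow graph -/

/-- Vertices of the information flow graph. -/
def Vertex (S : Schema) : Type := Ty S.P S.E

/-- An edge `a → b` with label `f (i, j)`: a rule (with function `f`) whose `i`-th input type is
`a` and whose `j`-th output type is `b` (indices start at `0` here). -/
structure Edge (S : Schema) (a b : S.Vertex) : Type where
  rule : Rule S.toTypeSystem
  mem : rule ∈ S.rules
  i : Fin rule.nIn
  j : Fin rule.nOut
  src : rule.inp i = a
  tgt : rule.out j = b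

/-- The information flow graph; its paths (walks) are `Quiver.Path`s. -/
instance flowGraph (S : Schema) : Quiver S.Vertex where
  Hom a b := S.Edge a b

/-- Paths (walks) of the information flow graph. -/
abbrev Walk (S : Schema) (a b : Ty S.P S.E) : Type :=
  @Quiver.Path S.Vertex (flowGraph S) a b

/-- All edges of the path carry a label `f (1, 1)` with `f` injective. -/
def IsInjChain (S : Schema) {a : S.Vertex} : {b : S.Vertex} → Quiver.Path a b → Prop
  | _, .nil => True
  | _, .cons p e => S.IsInjChain p ∧ Rule.IsInjective (Edge.rule e) ∧ (Edge.i e).val = 0 ∧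
      (Edge.j e).val = 0

/-- The path is a chain of injective functions followed by one edge that belongs to the rule
`final T`, where `T` is the type at which that last edge starts. -/
def EndsWith (S : Schema) (final : Ty S.P S.E → Rule S.toTypeSystem) {a b : S.Vertex}
    (p : Quiver.Path a b) : Prop :=
  ∃ (T : S.Vertex) (q : Quiver.Path a T) (e : T ⟶ b),
    p = q.cons e ∧ S.IsInjChain q ∧ Edge.rule e = final T

/-- Deterministic types. -/
structure IsDeterministic (S : Schema) (D : S.E) : Prop where
  to_boolean : ∀ p : S.Walk (.enc D) .boolean, S.EndsWith Rule.equal p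
  to_hashDom : ∀ p : S.Walk (.enc D) .hashDom, S.EndsWith Rule.hash p
  /-- Each intermediate type of a path to `boolean` or `hashDom` is reached by a unique path. -/
  unique : ∀ (T B : Ty S.P S.E) (q : S.Walk (.enc D) T) (r : S.Walk T B),
    B = .boolean ∨ B = .hashDom → 0 < q.length → 0 < r.length →
      ∀ q' : S.Walk (.enc D) T, q' = q
  no_plain : ∀ p : S.P, IsEmpty (S.Walk (.enc D) (.plain p))

/-- `e` is an encrypted type (possibly `D` itself) on a path from `D` to `boolean` or `hashDom`. -/
def OnLeakPath (S : Schema) (D e : S.E) : Prop :=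
  Nonempty (S.Walk (.enc D) (.enc e)) ∧
    (Nonempty (S.Walk (.enc e) .boolean) ∨ Nonempty (S.Walk (.enc e) .hashDom))

/-- Strictness: the values of the types on the paths from `D` to `boolean` and `hashDom` stem
from values of `D` only; every rule that outputs such a type has an input reachable from `D`. -/
def IsStrict (S : Schema) (D : S.E) : Prop :=
  ∀ e, S.OnLeakPath D e → ∀ r ∈ S.rules, ∀ j, Rule.out r j = .enc e →
    ∃ i, Nonempty (S.Walk (.enc D) (Rule.inp r i))

/-- All rules have at most `a` inputs and at most `a` outputs. -/
def ArityLE (S : Schema) (a : ℕ) : Prop :=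
  ∀ r ∈ S.rules, Rule.nIn r ≤ a ∧ Rule.nOut r ≤ a

/-! ## The trusted machine and the adversary's view -/

/-- How values of a type appear outside the trusted machine. -/
def Wire (S : Schema) : Ty S.P S.E → Type
  | .boolean => Option Bool
  | .hashDom => S.HashVal
  | .plain p => S.domP p
  | .enc e => (S.scheme e).Cipher

/-- One key for each encrypted type. -/
abbrev Keys (S : Schema) : Type := ∀ e, (S.scheme e).Key

/-- The part sampled so far of the hash functions, one random function for each type. -/
abbrev HashTable (S : Schema) : Type := ∀ T : Ty S.P S.E, S.Dom T → Option S.HashVal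

/-- Reading a value: ciphertexts are decrypted. -/
def decode (S : Schema) (k : S.Keys) : (T : Ty S.P S.E) → S.Wire T → Option (S.Dom T)
  | .boolean, v => some v
  | .hashDom, v => some v
  | .plain _, v => some v
  | .enc e, c => (S.scheme e).dec (k e) c

/-- Writing a value: values of encrypted types are encrypted. -/
def encode (S : Schema) (k : S.Keys) : (T : Ty S.P S.E) → S.Dom T → PMF (S.Wire T)
  | .boolean, v => PMF.pure v
  | .hashDom, v => PMF.pure v
  | .plain _, v => PMF.pure v
  | .enc e, v => (S.scheme e).enc (k e) v

/-- Independent samples. -/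
def pmfPi : {n : ℕ} → {α : Fin n → Type} → (∀ i, PMF (α i)) → PMF (∀ i, α i)
  | 0, _, _ => PMF.pure fun i => i.elim0
  | _ + 1, _, p => (p 0).bind fun a =>
      (pmfPi fun i => p i.succ).map fun f => Fin.cons a f

/-- Evaluation of a rule on plaintext values. Hash values are sampled lazily and uniformly. -/
def eval (S : Schema) (h : S.HashTable) : (r : Rule S.toTypeSystem) →
    (∀ i, S.Dom (r.inp i)) → PMF ((∀ j, S.Dom (r.out j)) × S.HashTable)
  | .fn _ _ _ _ f, x => PMF.pure (f x, h)
  | .equal T, x =>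
      let x₀ : S.Dom T := x (0 : Fin 2)
      let x₁ : S.Dom T := x (1 : Fin 2)
      PMF.pure (fun _ => some (decide (x₀ = x₁)), h)
  | .hash T, x =>
      let x₀ : S.Dom T := x (0 : Fin 1)
      match h T x₀ with
      | some v => PMF.pure (fun _ => v, h)
      | none => (PMF.uniformOfFintype S.HashVal).map fun v =>
          (fun _ => v, Function.update h T (Function.update (h T) x₀ (some v)))

/-- A call of the trusted machine: decrypt the inputs (the call fails if one of them is not a valid
ciphertext), evaluate, encrypt the outputs. -/
def tmCall (S : Schema) (k : S.Keys) (h : S.HashTable) (r : Rule S.toTypeSystem)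
    (args : ∀ i, S.Wire (r.inp i)) : PMF (Option (∀ j, S.Wire (r.out j)) × S.HashTable) :=
  if hx : ∀ i, (S.decode k (r.inp i) (args i)).isSome then
    (S.eval h r fun i => (S.decode k (r.inp i) (args i)).get (hx i)).bind fun y =>
      (pmfPi fun j => S.encode k (r.out j) (y.1 j)).map fun w => (some w, y.2)
  else PMF.pure (none, h)

/-- The adversary's queries: read an encrypted stored value of type `D`, encrypt a chosen value of
another type (not one on the paths from `D` to `boolean` or `hashDom`), and call the trusted
machine on any rule and any input. -/
inductive Query (S : Schema) (D : S.E) (ι : Type) : Type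
  | read (i : ι) : Query S D ι
  | encrypt (e : S.E) (he : ¬ S.OnLeakPath D e) (v : S.domE e) : Query S D ι
  | call (r : Rule S.toTypeSystem) (hr : r ∈ S.rules) (args : ∀ i, S.Wire (r.inp i)) : Query S D ι

/-- The adversary's interface. -/
def advI (S : Schema) (D : S.E) (ι : Type) : Interface where
  Q := S.Query D ι
  R := fun q => match q with
    | .read _ => (S.scheme D).Cipher
    | .encrypt e _ _ => (S.scheme e).Cipher
    | .call r _ _ => Option (∀ j, S.Wire (r.out j))

/-- The encrypted database whose stored values of type `D` are `d i`. -/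
def world (S : Schema) (D : S.E) {ι : Type} (d : ι → S.domE D) : System (S.advI D ι) where
  State := S.Keys × S.HashTable
  init := (PMF.uniformOfFintype S.Keys).map fun k => (k, fun _ _ => none)
  step := fun s q => match q with
    | .read i => ((S.scheme D).enc (s.1 D) (d i)).map fun c => (c, s)
    | .encrypt e _ v => ((S.scheme e).enc (s.1 e) v).map fun c => (c, s)
    | .call r _ args => (S.tmCall s.1 s.2 r args).map fun x => (x.1, (s.1, x.2))

/-- Two systems are indistinguishable up to the insecurity of the encryption schemes: there are
black-box reductions, independent of the adversary, that bound each adversary's distinguishing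
advantage by the IND-CPA and INT-CTXT advantages, one of each for every encrypted type and each of
the two systems. The reductions run the adversary once and make at most `a` left-or-right queries,
respectively `2 * a` encryption and verification queries, for each query of the adversary. -/
def Indist (S : Schema) (a : ℕ) {I : Interface} (W₀ W₁ : System I) : Prop :=
  ∃ (B : Bool → ∀ e, Emulator I (S.scheme e).cpaI) (F : Bool → ∀ e, Emulator I (S.scheme e).ctxtI),
    (∀ b e, (B b e).Cost a ∧ (F b e).Cost (2 * a)) ∧
    ∀ A : Prog I Bool, |A.prob W₀ true - A.prob W₁ true| ≤
      ∑ b : Bool, ∑ e : S.E,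
        ((S.scheme e).cpaAdv ((B b e).apply A) + (S.scheme e).ctxtAdv ((F b e).apply A))

end Schema

end EncDB

end

/-! Secrecy rests on two game hops followed by an exact comparison. First, the trusted machine looks
ciphertexts up in a table of those issued instead of decrypting them. By correctness of decryption
the two behaviours can only diverge once a valid ciphertext that was never issued is submitted, and
a union bound over the encrypted types charges this event to integrity
(`abs_world_sub_ctxtMachine_le`). Now the keys serve for encryption only, so a hybrid argument over
the encrypted types replaces every plaintext of a type reachable from `D` by a default, at the cost
of the left-or-right advantages (`abs_cpaMachine_sub_le`). Both hops isolate one key at a time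
(`run_apply_comp_isolate`).

After the hops, the games for `d₀` and `d₁` are exactly equivalent when the equality patterns agree.
This is a logical-relations argument (`machine_prob_eq`) with the relation `ValRel`: values that are
visible or not reachable from `D` coincide, and reachable values that can still leak have the same
history, that is, they come from the same stored index by the same functions with the same side
inputs. Reachable values that cannot leak are unconstrained, since their encryptions are masked.
Rules preserve the relation (`valRel_fn`): uniqueness of walks lets only one input of a rule with a
leaking output depend on `D`, and strictness excludes values of another origin. Injectivity along
the walk then makes equality of values of a leaking type the same in both games
(`SameHistory.eq_iff`), so `equal` gives the same answers and lazily sampled hashes can be coupled.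

The simulator takes any stored values that explain the given ciphertexts; these have the right
equality pattern. For the converse, stored values are carried along the chain of injective rules,
all side inputs being fixed defaults of unreachable types (`exists_lift`). The composite map is
injective, so the final `equal` or `hash` call decides equality. -/

noncomputable section

open scoped Classical

namespace EncDB

/-! ## Couplings of probability mass functions -/

/-- `p` and `q` have a coupling that is supported on the relation `R`. -/
def Coupled {α β : Type*} (R : α → β → Prop) (p : PMF α) (q : PMF β) : Prop :=
  ∃ μ : PMF (α × β), μ.map Prod.fst = p ∧ μ.map Prod.snd = q ∧ ∀ z ∈ μ.support, R z.1 z.2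

namespace Coupled

variable {α β γ δ : Type*}

theorem mono {R R' : α → β → Prop} {p : PMF α} {q : PMF β} (h : Coupled R p q)
    (hR : ∀ a b, R a b → R' a b) : Coupled R' p q := by
  obtain ⟨μ, h1, h2, h3⟩ := h
  exact ⟨μ, h1, h2, fun z hz => hR _ _ (h3 z hz)⟩

theorem pure {R : α → β → Prop} {a : α} {b : β} (h : R a b) :
    Coupled R (PMF.pure a) (PMF.pure b) := by
  refine ⟨PMF.pure (a, b), by simp [PMF.pure_map], by simp [PMF.pure_map], ?_⟩
  intro z hz
  rw [PMF.support_pure, Set.mem_singleton_iff] at hz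
  subst hz
  exact h

theorem map_same {R : α → β → Prop} (p : PMF γ) (f : γ → α) (g : γ → β)
    (h : ∀ c ∈ p.support, R (f c) (g c)) : Coupled R (p.map f) (p.map g) := by
  refine ⟨p.map fun c => (f c, g c), ?_, ?_, ?_⟩
  · rw [PMF.map_comp]; rfl
  · rw [PMF.map_comp]; rfl
  · intro z hz
    rw [PMF.support_map] at hz
    obtain ⟨c, hc, rfl⟩ := hz
    exact h c hc

theorem refl {R : α → α → Prop} (p : PMF α) (h : ∀ c ∈ p.support, R c c) : Coupled R p p := by
  simpa [PMF.map_id] using map_same (R := R) p id id h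

/-- The independent product serves as coupling. It is used where nothing about the first side
matters any more, for instance after a bad event. -/
theorem of_snd {R : α → β → Prop} (p : PMF α) (q : PMF β)
    (h : ∀ a, ∀ b ∈ q.support, R a b) : Coupled R p q := by
  refine ⟨p.bind fun a => q.map fun b => (a, b), ?_, ?_, ?_⟩
  · rw [PMF.map_bind]
    refine Eq.trans (congrArg p.bind (funext fun a => ?_)) (PMF.bind_pure p)
    rw [PMF.map_comp]
    exact PMF.map_const q a
  · rw [PMF.map_bind]
    refine Eq.trans (congrArg p.bind (funext fun a => ?_)) (PMF.bind_const p q)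
    rw [PMF.map_comp]
    exact PMF.map_id q
  · intro z hz
    simp only [PMF.mem_support_bind_iff, PMF.support_map, Set.mem_image] at hz
    obtain ⟨a, -, b, hb, rfl⟩ := hz
    exact h a b hb

/-- Couplings compose like kernels: the first coupling chooses a pair, and a coupling of the two
continuations is then drawn for that pair. -/
theorem bind {R : α → β → Prop} {R' : γ → δ → Prop} {p : PMF α} {q : PMF β} {f : α → PMF γ}
    {g : β → PMF δ} (h : Coupled R p q) (hf : ∀ a b, R a b → Coupled R' (f a) (g b)) :
    Coupled R' (p.bind f) (q.bind g) := by
  obtain ⟨μ, rfl, rfl, h3⟩ := h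
  have key : ∀ z : α × β, ∃ ν : PMF (γ × δ), ν.map Prod.fst = f z.1 ∧ ν.map Prod.snd = g z.2 ∧
      (R z.1 z.2 → ∀ w ∈ ν.support, R' w.1 w.2) := by
    intro z
    -- The kernel must be defined on all pairs. Unrelated pairs have mass zero under `μ`, and any
    -- coupling, here the independent one, will do for them.
    by_cases hz : R z.1 z.2
    · obtain ⟨ν, a, b, c⟩ := hf _ _ hz
      exact ⟨ν, a, b, fun _ => c⟩
    · obtain ⟨ν, a, b, -⟩ := of_snd (R := fun _ _ => True) (f z.1) (g z.2) (fun _ _ _ => trivial)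
      exact ⟨ν, a, b, fun h => absurd h hz⟩
  choose ν h1 h2 h4 using key
  refine ⟨μ.bind ν, ?_, ?_, ?_⟩
  · simp only [PMF.map_bind, h1, PMF.bind_map, Function.comp_def]
  · simp only [PMF.map_bind, h2, PMF.bind_map, Function.comp_def]
  · intro w hw
    rw [PMF.mem_support_bind_iff] at hw
    obtain ⟨z, hz, hw⟩ := hw
    exact h4 z (h3 z hz) w hw

theorem map {R : α → β → Prop} {R' : γ → δ → Prop} {p : PMF α} {q : PMF β} {f : α → γ}
    {g : β → δ} (h : Coupled R p q) (hf : ∀ a b, R a b → R' (f a) (g b)) :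
    Coupled R' (p.map f) (q.map g) :=
  h.bind fun a b hab => Coupled.pure (hf a b hab)

/-- Outputs that agree unless a bad event happens differ in probability by at most that event's
probability. -/
theorem abs_sub_le {p : PMF α} {q : PMF β} {f : α → γ} {g : β → γ} {bad : β → Prop}
    (h : Coupled (fun a b => bad b ∨ f a = g b) p q) (c : γ) :
    |((p.map f) c).toReal - ((q.map g) c).toReal| ≤ (q.toOuterMeasure {b | bad b}).toReal := by
  obtain ⟨μ, rfl, rfl, h3⟩ := h
  have e1 : (PMF.map f (PMF.map Prod.fst μ)) c = μ.toOuterMeasure {z | f z.1 = c} := by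
    rw [PMF.map_comp, ← PMF.toOuterMeasure_apply_singleton, PMF.toOuterMeasure_map_apply]; rfl
  have e2 : (PMF.map g (PMF.map Prod.snd μ)) c = μ.toOuterMeasure {z | g z.2 = c} := by
    rw [PMF.map_comp, ← PMF.toOuterMeasure_apply_singleton, PMF.toOuterMeasure_map_apply]; rfl
  have e3 : (PMF.map Prod.snd μ).toOuterMeasure {b | bad b} = μ.toOuterMeasure {z | bad z.2} := by
    rw [PMF.toOuterMeasure_map_apply]; rfl
  have fin : ∀ s : Set (α × β), μ.toOuterMeasure s ≠ ⊤ := fun s => by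
    refine ne_top_of_le_ne_top ENNReal.one_ne_top ?_
    rw [← (PMF.toOuterMeasure_apply_eq_one_iff (p := μ) (s := Set.univ)).2 (Set.subset_univ _)]
    exact μ.toOuterMeasure.mono (Set.subset_univ _)
  -- On the support of the coupling, one output event is contained in the union of the other with
  -- the bad event; the second inequality is symmetric.
  have i1 : μ.toOuterMeasure {z | f z.1 = c} ≤
      μ.toOuterMeasure {z | g z.2 = c} + μ.toOuterMeasure {z | bad z.2} := by
    refine le_trans (PMF.toOuterMeasure_mono μ ?_) (MeasureTheory.measure_union_le _ _)
    rintro z ⟨hz, hs⟩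
    rcases h3 z hs with hb | he
    · exact Or.inr hb
    · exact Or.inl (he.symm.trans hz)
  have i2 : μ.toOuterMeasure {z | g z.2 = c} ≤
      μ.toOuterMeasure {z | f z.1 = c} + μ.toOuterMeasure {z | bad z.2} := by
    refine le_trans (PMF.toOuterMeasure_mono μ ?_) (MeasureTheory.measure_union_le _ _)
    rintro z ⟨hz, hs⟩
    rcases h3 z hs with hb | he
    · exact Or.inr hb
    · exact Or.inl (he.trans hz)
  rw [e1, e2, e3]
  have j1 := ENNReal.toReal_mono (ENNReal.add_ne_top.2 ⟨fin _, fin _⟩) i1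
  have j2 := ENNReal.toReal_mono (ENNReal.add_ne_top.2 ⟨fin _, fin _⟩) i2
  rw [ENNReal.toReal_add (fin _) (fin _)] at j1 j2
  rw [abs_le]
  constructor <;> linarith

end Coupled

/-! ## Programs -/

namespace Prog

variable {I : Interface} {α β : Type}

theorem runFrom_bind (O : System I) (A : Prog I α) (f : α → Prog I β) (s : O.State) :
    (A.bind f).runFrom O s = (A.runFrom O s).bind fun x => (f x.1).runFrom O x.2 := by
  induction A generalizing s with
  | ret a => simp [Prog.bind, runFrom]
  | ask q k ih => simp [Prog.bind, runFrom, ih, PMF.bind_bind]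
  | sample p k ih => simp [Prog.bind, runFrom, ih, PMF.bind_bind]

theorem AtMost.mono {A : Prog I α} {m n : ℕ} (h : A.AtMost m) (hmn : m ≤ n) : A.AtMost n := by
  induction A generalizing m n with
  | ret a => trivial
  | ask q k ih =>
    cases m with
    | zero => exact h.elim
    | succ m =>
      cases n with
      | zero => omega
      | succ n => exact fun r => ih r (h r) (by omega)
  | sample p k ih => exact fun b => ih b (h b) hmn

theorem AtMost.bind {A : Prog I α} {f : α → Prog I β} {m n : ℕ} (h : A.AtMost m)
    (hf : ∀ a, (f a).AtMost n) : (A.bind f).AtMost (m + n) := by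
  induction A generalizing m with
  | ret a => exact (hf a).mono (by omega)
  | ask q k ih =>
    cases m with
    | zero => exact h.elim
    | succ m =>
      rw [show m + 1 + n = (m + n) + 1 by omega]
      exact fun r => ih r (h r)
  | sample p k ih => exact fun b => ih b (h b)

/-- Runs programs one after the other, passing a state along. -/
def traverse {σ : Type} : {n : ℕ} → {α : Fin n → Type} → (∀ i, σ → Prog I (α i × σ)) → σ →
    Prog I ((∀ i, α i) × σ)
  | 0, _, _, s => ret (fun i => i.elim0, s)
  | _ + 1, _, g, s => (g 0 s).bind fun x =>
      (traverse (fun i => g i.succ) x.2).bind fun y => ret (Fin.cons x.1 y.1, y.2)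

theorem AtMost.traverse {σ : Type} {n : ℕ} {α : Fin n → Type} {g : ∀ i, σ → Prog I (α i × σ)}
    {c : ℕ} (h : ∀ i s, (g i s).AtMost c) (s : σ) : (Prog.traverse g s).AtMost (n * c) := by
  induction n generalizing s with
  | zero => trivial
  | succ n ih =>
    rw [show (n + 1) * c = c + (n * c + 0) by ring]
    exact (h 0 s).bind fun x => (ih (fun i => h i.succ) x.2).bind fun y => trivial

/-- A property of oracle states that no query destroys survives the run of a program. -/
theorem runFrom_preserves {O : System I} {P : O.State → Prop}
    (hP : ∀ s q, P s → ∀ x ∈ (O.step s q).support, P x.2) (A : Prog I α) (s : O.State) (hs : P s) :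
    ∀ x ∈ (A.runFrom O s).support, P x.2 := by
  induction A generalizing s with
  | ret a =>
    intro x hx
    simp only [runFrom, PMF.support_pure, Set.mem_singleton_iff] at hx
    exact hx ▸ hs
  | ask q k ih =>
    intro x hx
    simp only [runFrom, PMF.mem_support_bind_iff] at hx
    obtain ⟨y, hy, hx⟩ := hx
    exact ih _ _ (hP s q hs y hy) x hx
  | sample p k ih =>
    intro x hx
    simp only [runFrom, PMF.mem_support_bind_iff] at hx
    obtain ⟨y, hy, hx⟩ := hx
    exact ih _ _ hs x hx

/-- Systems that behave alike up to a bad event of the second one. -/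
theorem runFrom_coupled {O O' : System I} {R : O.State → O'.State → Prop} {bad : O'.State → Prop}
    (hbad : ∀ s q, bad s → ∀ x ∈ (O'.step s q).support, bad x.2)
    (hstep : ∀ s s' q, R s s' → Coupled (fun x y => bad y.2 ∨ (x.1 = y.1 ∧ R x.2 y.2))
      (O.step s q) (O'.step s' q)) (A : Prog I α) (s : O.State) (s' : O'.State)
    (h : bad s' ∨ R s s') :
    Coupled (fun x y => bad y.2 ∨ (x.1 = y.1 ∧ R x.2 y.2)) (A.runFrom O s) (A.runFrom O' s') := by
  induction A generalizing s s' with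
  | ret a => exact Coupled.pure (h.imp_right fun h => ⟨rfl, h⟩)
  | ask q k ih =>
    rcases h with hb | h
    -- Once the bad event has happened it persists, so the two runs need not be matched any longer.
    · exact Coupled.of_snd _ _ fun _ b hb' => Or.inl (runFrom_preserves hbad _ _ hb b hb')
    · refine (hstep s s' q h).bind fun x y hxy => ?_
      rcases hxy with hb | ⟨h1, h2⟩
      · exact Coupled.of_snd _ _ fun _ b hb' => Or.inl (runFrom_preserves hbad _ _ hb b hb')
      · rw [h1]; exact ih _ _ _ (Or.inr h2)
  | sample p k ih =>
    refine (Coupled.refl (R := Eq) p fun _ _ => rfl).bind fun a b hab => ?_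
    subst hab
    exact ih _ _ _ h

theorem run_coupled {O O' : System I} {R : O.State → O'.State → Prop} {bad : O'.State → Prop}
    (hbad : ∀ s q, bad s → ∀ x ∈ (O'.step s q).support, bad x.2)
    (hinit : Coupled R O.init O'.init)
    (hstep : ∀ s s' q, R s s' → Coupled (fun x y => bad y.2 ∨ (x.1 = y.1 ∧ R x.2 y.2))
      (O.step s q) (O'.step s' q)) (A : Prog I α) :
    Coupled (fun x y => bad y.2 ∨ (x.1 = y.1 ∧ R x.2 y.2)) (A.run O) (A.run O') :=
  hinit.bind fun _ _ h => runFrom_coupled hbad hstep A _ _ (Or.inr h)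

/-- Bisimilar systems cannot be distinguished. -/
theorem prob_eq_of_coupled {O O' : System I} {R : O.State → O'.State → Prop}
    (hinit : Coupled R O.init O'.init)
    (hstep : ∀ s s' q, R s s' → Coupled (fun x y => x.1 = y.1 ∧ R x.2 y.2)
      (O.step s q) (O'.step s' q)) (A : Prog I α) (a : α) :
    A.prob O a = A.prob O' a := by
  obtain ⟨μ, h1, h2, h3⟩ := run_coupled (bad := fun _ => False) (fun _ _ h => h.elim) hinit
    (fun s s' q h => (hstep s s' q h).mono fun x y h => Or.inr h) A
  have h : (A.run O).map Prod.fst = (A.run O').map Prod.fst := by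
    rw [← h1, ← h2, PMF.map_comp, PMF.map_comp]
    change μ.bind _ = μ.bind _
    ext c
    simp only [PMF.bind_apply]
    refine tsum_congr fun z => ?_
    by_cases hz : μ z = 0
    · simp [hz]
    · rcases h3 z ((PMF.mem_support_iff _ _).2 hz) with hf | hf
      · exact hf.elim
      · simp [Function.comp, hf.1]
  unfold prob
  rw [h]

end Prog

/-! ## Homomorphisms of systems -/

/-- A map of states that commutes with the behaviour of two systems. -/
structure System.IsHom {I : Interface} (O O' : System I) (φ : O.State → O'.State) : Prop where
  init : O.init.map φ = O'.init
  step : ∀ s q, (O.step s q).map (Prod.map id φ) = O'.step (φ s) q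

namespace System.IsHom

variable {I : Interface} {O O' : System I} {φ : O.State → O'.State} {α : Type}

theorem runFrom (h : O.IsHom O' φ) (A : Prog I α) (s : O.State) :
    (A.runFrom O s).map (Prod.map id φ) = A.runFrom O' (φ s) := by
  induction A generalizing s with
  | ret a => simp [Prog.runFrom, PMF.pure_map]
  | ask q k ih =>
    simp only [Prog.runFrom, PMF.map_bind, ih, ← h.step, PMF.bind_map, Function.comp_def]
    rfl
  | sample p k ih => simp only [Prog.runFrom, PMF.map_bind, ih]

theorem run (h : O.IsHom O' φ) (A : Prog I α) :
    (A.run O).map (Prod.map id φ) = A.run O' := by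
  simp only [Prog.run, PMF.map_bind, h.runFrom, ← h.init, PMF.bind_map, Function.comp_def]

end System.IsHom

/-! ## Composition of emulators -/

namespace Emulator

variable {I J K : Interface} {α : Type}

/-- The system that an emulator forms together with its oracle. -/
abbrev onSystem (M : Emulator I J) (O : System J) : System I where
  State := M.State × O.State
  init := M.init.bind fun s => O.init.map fun o => (s, o)
  step := fun s q => ((M.step s.1 q).runFrom O s.2).map fun x => (x.1.1, (x.1.2, x.2))

theorem runFrom_applyFrom (M : Emulator I J) (O : System J) (A : Prog I α) (s : M.State)
    (o : O.State) : (M.applyFrom A s).runFrom O o =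
      (A.runFrom (M.onSystem O) (s, o)).map fun x => (x.1, x.2.2) := by
  induction A generalizing s o with
  | ret a => simp [Prog.runFrom, applyFrom, PMF.pure_map]
  | ask q k ih =>
    simp only [Prog.runFrom, applyFrom, Prog.runFrom_bind, ih, PMF.map_bind, onSystem,
      PMF.bind_map, Function.comp_def]
  | sample p k ih => simp only [Prog.runFrom, applyFrom, ih, PMF.map_bind]

/-- This change of viewpoint carries the reductions: a program on top of an emulator is the original
adversary facing a larger system, so reductions can be analysed by comparing systems. -/
theorem run_apply (M : Emulator I J) (O : System J) (A : Prog I α) :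
    (M.apply A).run O = (A.run (M.onSystem O)).map fun x => (x.1, x.2.2) := by
  simp only [Prog.run, apply, Prog.runFrom, runFrom_applyFrom]
  -- `apply` samples the emulator's state after the oracle's, `onSystem` before it; independent
  -- draws commute.
  rw [PMF.bind_comm]
  simp only [onSystem, PMF.bind_bind, PMF.bind_map, PMF.map_bind, Function.comp_def]

theorem onSystem_isHom (M : Emulator I J) {O O' : System J} {φ : O.State → O'.State}
    (h : O.IsHom O' φ) : (M.onSystem O).IsHom (M.onSystem O') (Prod.map id φ) where
  init := by
    simp only [onSystem, ← h.init, PMF.map_bind, PMF.map_comp]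
    rfl
  step := fun s q => by
    change PMF.map _ (PMF.map _ _) = PMF.map _ (Prog.runFrom O' (M.step s.1 q) (φ s.2))
    rw [← h.runFrom]
    refine (PMF.map_comp _ _ _).trans (Eq.trans ?_ (PMF.map_comp _ _ _).symm)
    rfl

/-- Runs a program on top of an emulator and returns the emulator's final state as well. -/
def lift (N : Emulator J K) : Prog J α → N.State → Prog K (α × N.State)
  | .ret a, s => .ret (a, s)
  | .ask q k, s => (N.step s q).bind fun x => lift N (k x.1) x.2
  | .sample p k, s => .sample p fun b => lift N (k b) s

theorem runFrom_lift (N : Emulator J K) (O : System K) (A : Prog J α) (s : N.State)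
    (o : O.State) : (N.lift A s).runFrom O o =
      (A.runFrom (N.onSystem O) (s, o)).map fun x => ((x.1, x.2.1), x.2.2) := by
  induction A generalizing s o with
  | ret a => simp [Prog.runFrom, lift, PMF.pure_map]
  | ask q k ih =>
    simp only [Prog.runFrom, lift, Prog.runFrom_bind, ih, PMF.map_bind, onSystem,
      PMF.bind_map, Function.comp_def]
  | sample p k ih => simp only [Prog.runFrom, lift, ih, PMF.map_bind]

theorem atMost_lift {N : Emulator J K} (hN : N.Cost 1) {A : Prog J α} {n : ℕ} (hA : A.AtMost n)
    (s : N.State) : (N.lift A s).AtMost n := by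
  induction A generalizing s n with
  | ret a => trivial
  | ask q k ih =>
    cases n with
    | zero => exact hA.elim
    | succ n =>
      rw [add_comm]
      exact (hN s q).bind fun x => ih _ (hA _) _
  | sample p k ih => exact fun b => ih b (hA b) s

/-- Composition of emulators. -/
abbrev comp (M : Emulator I J) (N : Emulator J K) : Emulator I K where
  State := M.State × N.State
  init := M.init.bind fun s => N.init.map fun t => (s, t)
  step := fun s q => (N.lift (M.step s.1 q) s.2).bind fun x => .ret (x.1.1, (x.1.2, x.2))

theorem Cost.comp {M : Emulator I J} {N : Emulator J K} {n : ℕ} (hM : M.Cost n) (hN : N.Cost 1) :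
    (M.comp N).Cost n := fun s q =>
  (Prog.AtMost.bind (n := 0) (atMost_lift hN (hM s.1 q) s.2) fun _ => trivial)

/-- Only the nesting of the three state components differs between the two systems. -/
theorem comp_isHom (M : Emulator I J) (N : Emulator J K) (O : System K) :
    ((M.comp N).onSystem O).IsHom (M.onSystem (N.onSystem O)) fun x => (x.1.1, (x.1.2, x.2)) where
  init := by
    simp only [onSystem, comp, PMF.map_bind, PMF.map_comp, PMF.bind_bind, PMF.bind_map,
      Function.comp_def]
  step := fun s q => by
    simp only [onSystem, comp, Prog.runFrom_bind, runFrom_lift, PMF.map_bind,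
      PMF.bind_map, Prog.runFrom, PMF.pure_map, Function.comp_def, Prod.map, id]
    rfl

end Emulator

/-! ## Families of oracles -/

/-- The interface of a family of oracles. -/
abbrev piI {E : Type} (J : E → Interface) : Interface where
  Q := Σ e, (J e).Q
  R := fun q => (J q.1).R q.2

section Pi

variable {E : Type} {J : E → Interface} {St : E → Type}

/-- A family of oracles, side by side; the initial states are drawn jointly. -/
abbrev piSystem (ini : PMF (∀ e, St e)) (stp : ∀ e, St e → (q : (J e).Q) → PMF ((J e).R q × St e)) :
    System (piI J) where
  State := ∀ e, St e
  init := ini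
  step := fun s q => (stp q.1 (s q.1) q.2).map fun x => (x.1, Function.update s q.1 x.2)

/-- Emulates all members of a family but one, which is given as an oracle. -/
abbrev isolate (ini : PMF (∀ e, St e)) (stp : ∀ e, St e → (q : (J e).Q) → PMF ((J e).R q × St e))
    (e : E) : Emulator (piI J) (J e) where
  State := ∀ e, St e
  init := ini
  step := fun s q => match q with
    | ⟨e', q⟩ =>
      if h : e = e' then by
        subst h
        exact .ask q fun r => .ret (r, s)
      else .sample (stp e' (s e') q) fun x => .ret (x.1, Function.update s e' x.2)

theorem isolate_cost (ini : PMF (∀ e, St e))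
    (stp : ∀ e, St e → (q : (J e).Q) → PMF ((J e).R q × St e)) (e : E) :
    (isolate ini stp e).Cost 1 := by
  rintro s ⟨e', q⟩
  by_cases h : e = e'
  · subst h
    simp only [isolate, dif_pos]
    exact fun _ => trivial
  · simp only [isolate, dif_neg h]
    exact fun _ => trivial

/-- The emulator keeps a dummy state for the isolated member, which is overwritten by the state of
the real oracle. `hini` says that this does not disturb the joint initial law. The family `stp'` may
differ from `stp` at `e` alone, so one emulator serves both sides of a hybrid step. -/
theorem isolate_isHom {ini : PMF (∀ e, St e)}
    {stp stp' : ∀ e, St e → (q : (J e).Q) → PMF ((J e).R q × St e)} {e : E} {inie : PMF (St e)}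
    (hini : (ini.bind fun s => inie.map fun o => Function.update s e o) = ini)
    (hstp : ∀ e', e ≠ e' → stp e' = stp' e') :
    ((isolate ini stp e).onSystem ⟨St e, inie, stp' e⟩).IsHom (piSystem ini stp')
      fun x => Function.update x.1 e x.2 where
  init := by
    refine Eq.trans ?_ hini
    change PMF.map _ (PMF.bind ini fun s => PMF.map _ inie) = _
    rw [PMF.map_bind]
    refine congrArg _ (funext fun s => ?_)
    rw [PMF.map_comp]
    rfl
  step := by
    rintro ⟨s, o⟩ ⟨e', q⟩
    by_cases h : e = e'
    · subst h
      have h1 : (isolate ini stp e).step s ⟨e, q⟩ = .ask q fun r => .ret (r, s) := by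
        simp only [isolate, dif_pos]
      change PMF.map _ (PMF.map _ (Prog.runFrom _ ((isolate ini stp e).step s ⟨e, q⟩) o)) =
        PMF.map _ (stp' e (Function.update s e o e) q)
      rw [h1, Function.update_self]
      change PMF.map _ (PMF.map _ (PMF.map _ _)) = _
      refine (congrArg _ (PMF.map_comp _ _ _)).trans ((PMF.map_comp _ _ _).trans ?_)
      refine congrArg (fun f => PMF.map f (stp' e o q)) (funext fun x => ?_)
      simp [Function.comp_def]
    · have h1 : (isolate ini stp e).step s ⟨e', q⟩ =
          .sample (stp e' (s e') q) fun x => .ret (x.1, Function.update s e' x.2) := by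
        simp only [isolate, dif_neg h]
      change PMF.map _ (PMF.map _ (Prog.runFrom _ ((isolate ini stp e).step s ⟨e', q⟩) o)) =
        PMF.map _ (stp' e' (Function.update s e o e') q)
      rw [h1, Function.update_of_ne (Ne.symm h), hstp e' h]
      change PMF.map _ (PMF.map _ (PMF.map _ _)) = _
      refine (congrArg _ (PMF.map_comp _ _ _)).trans ((PMF.map_comp _ _ _).trans ?_)
      refine congrArg (fun f => PMF.map f (stp' e' (s e') q)) (funext fun x => ?_)
      simp [Function.comp_def, Function.update_comm h]

/-- Resampling one coordinate of a uniformly distributed family does not change its law. -/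
theorem uniform_bind_update [Fintype E] (X : E → Type) [∀ e, Fintype (X e)] [∀ e, Nonempty (X e)]
    (e : E) : ((PMF.uniformOfFintype (∀ e, X e)).bind fun s =>
      (PMF.uniformOfFintype (X e)).map fun o => Function.update s e o) =
        PMF.uniformOfFintype (∀ e, X e) := by
  ext k
  rw [PMF.bind_apply]
  simp only [PMF.map_apply, PMF.uniformOfFintype_apply, tsum_fintype]
  have h1 : ∀ s : ∀ e, X e, (∑ o : X e, if k = Function.update s e o then
      (Fintype.card (X e) : ENNReal)⁻¹ else 0) =
        if ∃ o, s = Function.update k e o then (Fintype.card (X e) : ENNReal)⁻¹ else 0 := by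
    intro s
    split_ifs with h
    · obtain ⟨o, rfl⟩ := h
      rw [Finset.sum_eq_single (k e)]
      · simp
      · intro o' _ ho'
        rw [if_neg]
        intro h
        apply ho'
        have := congrFun h e
        simpa using this.symm
      · simp
    · refine Finset.sum_eq_zero fun o _ => if_neg fun hk => h ⟨s e, ?_⟩
      subst hk
      simp
  simp only [h1, ← Finset.mul_sum]
  -- The families that can be turned into `k` by changing coordinate `e` are as many as the elements
  -- of `X e`.
  have h2 : (∑ s : ∀ e, X e, if ∃ o, s = Function.update k e o then
      (Fintype.card (X e) : ENNReal)⁻¹ else 0) = 1 := by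
    rw [← Finset.sum_filter, Finset.sum_const]
    have : (Finset.univ.filter fun s : ∀ e, X e => ∃ o, s = Function.update k e o) =
        Finset.univ.map ⟨Function.update k e, Function.update_injective k e⟩ := by
      ext s
      simp [eq_comm]
    rw [this, Finset.card_map, Finset.card_univ, nsmul_eq_mul]
    exact ENNReal.mul_inv_cancel (by simp) (by simp)
  rw [h2, mul_one]

theorem uniform_map_bind_update [Fintype E] (X : E → Type) [∀ e, Fintype (X e)]
    [∀ e, Nonempty (X e)] (g : ∀ e, X e → St e) (e : E) :
    (((PMF.uniformOfFintype (∀ e, X e)).map fun k e => g e (k e)).bind fun s =>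
      ((PMF.uniformOfFintype (X e)).map (g e)).map fun o => Function.update s e o) =
        (PMF.uniformOfFintype (∀ e, X e)).map fun k e => g e (k e) := by
  conv_rhs => rw [← uniform_bind_update X e]
  simp only [PMF.map_bind, PMF.bind_map, PMF.map_comp, Function.comp_def]
  refine congrArg _ (funext fun k => congrArg (fun f => PMF.map f _)
    (funext fun o => funext fun e' => ?_))
  by_cases h : e' = e
  · subst h; simp
  · simp [Function.update_of_ne h]

/-- A program run on an emulator on top of one isolated oracle behaves as on the whole family. -/
theorem run_apply_comp_isolate {I : Interface} {α : Type} (M : Emulator I (piI J))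
    {ini : PMF (∀ e, St e)} {stp stp' : ∀ e, St e → (q : (J e).Q) → PMF ((J e).R q × St e)} {e : E}
    {inie : PMF (St e)} (hini : (ini.bind fun s => inie.map fun o => Function.update s e o) = ini)
    (hstp : ∀ e', e ≠ e' → stp e' = stp' e') (A : Prog I α) :
    ((M.comp (isolate ini stp e)).apply A).run ⟨St e, inie, stp' e⟩ =
      (A.run (M.onSystem (piSystem ini stp'))).map fun x => (x.1, x.2.2 e) := by
  rw [Emulator.run_apply, ← (M.onSystem_isHom (isolate_isHom hini hstp)).run A,
    ← (M.comp_isHom (isolate ini stp e) ⟨St e, inie, stp' e⟩).run A, PMF.map_comp, PMF.map_comp]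
  refine congrArg (fun f => PMF.map f _) (funext fun x => Prod.ext rfl ?_)
  exact (Function.update_self (β := St) e x.2.2 x.2.1.2).symm

end Pi

/-! ### Couplings of sequential and independent compositions -/

namespace Prog

/-- Step-wise coupled traversals are coupled. -/
theorem traverse_coupled {I I' : Interface} {O : System I} {O' : System I'} {σ σ' : Type} {n : ℕ}
    {α β : Fin n → Type} {g : ∀ i, σ → Prog I (α i × σ)} {g' : ∀ i, σ' → Prog I' (β i × σ')}
    {Rv : ∀ i, α i → β i → Prop} {R : σ → O.State → σ' → O'.State → Prop}
    (h : ∀ i s o s' o', R s o s' o' →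
      Coupled (fun x y => Rv i x.1.1 y.1.1 ∧ R x.1.2 x.2 y.1.2 y.2)
        ((g i s).runFrom O o) ((g' i s').runFrom O' o'))
    (s : σ) (o : O.State) (s' : σ') (o' : O'.State) (hs : R s o s' o') :
    Coupled (fun x y => (∀ i, Rv i (x.1.1 i) (y.1.1 i)) ∧ R x.1.2 x.2 y.1.2 y.2)
      ((traverse g s).runFrom O o) ((traverse g' s').runFrom O' o') := by
  induction n generalizing s o s' o' with
  | zero => exact Coupled.pure ⟨fun i => i.elim0, hs⟩
  | succ n ih =>
    simp only [traverse, runFrom_bind]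
    refine (h 0 s o s' o' hs).bind fun x y hxy => ?_
    refine (ih (Rv := fun i => Rv i.succ) (fun i => h i.succ) _ _ _ _ hxy.2).bind
      fun x' y' hxy' => Coupled.pure ⟨fun i => ?_, hxy'.2⟩
    refine Fin.cases ?_ (fun i => ?_) i
    · exact hxy.1
    · exact hxy'.1 i

/-- Independent samples are coupled to a traversal as soon as this holds step by step. -/
theorem pmfPi_coupled {I : Interface} {O : System I} {σ : Type} {n : ℕ}
    {α β : Fin n → Type} {p : ∀ i, PMF (α i)} {g : ∀ i, σ → Prog I (β i × σ)}
    {Rv : ∀ i, α i → β i → Prop} {R : σ → O.State → Prop}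
    (h : ∀ i s o, R s o → Coupled (fun x y => Rv i x y.1.1 ∧ R y.1.2 y.2)
        (p i) ((g i s).runFrom O o)) (s : σ) (o : O.State) (hs : R s o) :
    Coupled (fun x y => (∀ i, Rv i (x i) (y.1.1 i)) ∧ R y.1.2 y.2)
      (Schema.pmfPi p) ((traverse g s).runFrom O o) := by
  induction n generalizing s o with
  | zero => exact Coupled.pure ⟨fun i => i.elim0, hs⟩
  | succ n ih =>
    simp only [traverse, runFrom_bind, Schema.pmfPi]
    refine (h 0 s o hs).bind fun x y hxy => ?_
    refine (ih (Rv := fun i => Rv i.succ) (fun i => h i.succ) _ _ hxy.2).bind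
      fun x' y' hxy' => Coupled.pure ⟨fun i => ?_, hxy'.2⟩
    refine Fin.cases ?_ (fun i => ?_) i
    · exact hxy.1
    · exact hxy'.1 i

end Prog

namespace Schema

variable {S : Schema}

/-! ## The trusted machine with tables instead of decryption -/

/-- For every encrypted type, the ciphertexts issued so far with their plaintexts. -/
abbrev Tables (S : Schema) : Type := ∀ e, (S.scheme e).Cipher → Option (S.domE e)

/-- Reading a value with the help of the tables. -/
def lookup (t : S.Tables) : (T : Ty S.P S.E) → S.Wire T → Option (S.Dom T)
  | .boolean, v => some v
  | .hashDom, v => some v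
  | .plain _, v => some v
  | .enc e, c => t e c

/-- An encryption service: encryption and a check for forgeries. -/
structure Service (S : Schema) (K : Interface) where
  enc : ∀ e, S.domE e → Prog K (S.scheme e).Cipher
  chk : ∀ e, (S.scheme e).Cipher → Prog K Unit

namespace Service

variable {K : Interface} (V : S.Service K)

/-- Writing a value and recording its ciphertext. -/
def emit : (T : Ty S.P S.E) → S.Dom T → S.Tables → Prog K (S.Wire T × S.Tables)
  | .boolean, v, t => .ret (v, t)
  | .hashDom, v, t => .ret (v, t)
  | .plain _, v, t => .ret (v, t)
  | .enc e, v, t => (V.enc e v).bind fun c =>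
      .ret (c, Function.update t e (Function.update (t e) c (some v)))

/-- Checking a value for being a forgery. -/
def check : (T : Ty S.P S.E) → S.Wire T → Unit → Prog K (Unit × Unit)
  | .boolean, _, _ => .ret ((), ())
  | .hashDom, _, _ => .ret ((), ())
  | .plain _, _, _ => .ret ((), ())
  | .enc e, c, _ => (V.chk e c).bind fun _ => .ret ((), ())

/-- A call of the trusted machine, the inputs being looked up in the tables. -/
def call (s : S.HashTable × S.Tables) (r : Rule S.toTypeSystem) (args : ∀ i, S.Wire (r.inp i)) :
    Prog K (Option (∀ j, S.Wire (r.out j)) × (S.HashTable × S.Tables)) :=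
  if hx : ∀ i, (lookup s.2 (r.inp i) (args i)).isSome then
    .sample (S.eval s.1 r fun i => (lookup s.2 (r.inp i) (args i)).get (hx i)) fun y =>
      (Prog.traverse (fun j => V.emit (r.out j) (y.1 j)) s.2).bind fun w =>
        .ret (some w.1, (y.2, w.2))
  else .ret (none, s)

/-- The database with tables, as an emulator on top of an encryption service. -/
def machine (D : S.E) {ι : Type} (d : ι → S.domE D) : Emulator (S.advI D ι) K where
  State := S.HashTable × S.Tables
  init := PMF.pure (fun _ _ => none, fun _ _ => none)
  step := fun s q => match q with
    | .read i => (V.emit (.enc D) (d i) s.2).bind fun x => .ret (x.1, (s.1, x.2))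
    | .encrypt e _ v => (V.emit (.enc e) v s.2).bind fun x => .ret (x.1, (s.1, x.2))
    | .call r _ args => (Prog.traverse (fun i => V.check (r.inp i) (args i)) ()).bind fun _ =>
        V.call s r args

variable {V}

theorem emit_atMost (h : ∀ e v, (V.enc e v).AtMost 1) (T : Ty S.P S.E) (v : S.Dom T)
    (t : S.Tables) : (V.emit T v t).AtMost 1 := by
  cases T with
  | enc e => exact (h e v).bind (n := 0) fun _ => trivial
  | _ => trivial

theorem check_atMost {c : ℕ} (h : ∀ e x, (V.chk e x).AtMost c) (T : Ty S.P S.E) (v : S.Wire T)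
    (u : Unit) : (V.check T v u).AtMost c := by
  cases T with
  | enc e => exact (h e v).bind (n := 0) fun _ => trivial
  | _ => trivial

/-- A call of the trusted machine is the expensive query: up to `a` inputs with `c` queries each for
the check, and up to `a` outputs with one encryption each. The other queries need a single
encryption, which is covered by `1 ≤ a`. -/
theorem machine_cost {a c : ℕ} (ha : 1 ≤ a) (hS : S.ArityLE a) (h : ∀ e v, (V.enc e v).AtMost 1)
    (hc : ∀ e x, (V.chk e x).AtMost c) {D : S.E} {ι : Type} (d : ι → S.domE D) :
    (V.machine D d).Cost (a * c + a) := by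
  rintro s (i | ⟨e, he, v⟩ | ⟨r, hr, args⟩)
  · refine Prog.AtMost.mono (m := 1 + 0) ?_ (by omega)
    exact (emit_atMost h _ _ _).bind fun _ => trivial
  · refine Prog.AtMost.mono (m := 1 + 0) ?_ (by omega)
    exact (emit_atMost h _ _ _).bind fun _ => trivial
  · refine Prog.AtMost.mono (m := r.nIn * c + (r.nOut * 1 + 0)) ?_ ?_
    · refine (Prog.AtMost.traverse (fun i u => check_atMost hc _ _ _) _).bind fun _ => ?_
      unfold call
      split_ifs with hx
      · intro y
        exact Prog.AtMost.bind (n := 0)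
          (Prog.AtMost.traverse (fun j t => emit_atMost h (r.out j) (y.1 j) t) _) fun _ => trivial
      · trivial
    · have := Nat.mul_le_mul_right c (hS r hr).1
      have := (hS r hr).2
      omega

end Service

/-- Tables with the same ciphertexts and related plaintexts. -/
def TablesRel (VR : ∀ T, S.Dom T → S.Dom T → Prop) (t t' : S.Tables) : Prop :=
  ∀ e c, Option.Rel (VR (.enc e)) (t e c) (t' e c)

theorem lookup_rel {VR : ∀ T, S.Dom T → S.Dom T → Prop}
    (hpl : ∀ T, (∀ e, T ≠ .enc e) → ∀ v w, VR T v w ↔ v = w) {t t' : S.Tables}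
    (ht : TablesRel VR t t') (T : Ty S.P S.E) (w : S.Wire T) :
    Option.Rel (VR T) (lookup t T w) (lookup t' T w) := by
  cases T with
  | enc e => exact ht e w
  | _ => exact Option.Rel.some ((hpl _ (by simp) _ _).2 rfl)

theorem _root_.Option.Rel.isSome_eq {α β : Type*} {R : α → β → Prop} {x : Option α} {y : Option β}
    (h : Option.Rel R x y) : x.isSome = y.isSome := by
  cases h <;> rfl

theorem _root_.Option.Rel.get {α β : Type*} {R : α → β → Prop} {x : Option α} {y : Option β}
    (h : Option.Rel R x y) (hx : x.isSome) (hy : y.isSome) : R (x.get hx) (y.get hy) := by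
  cases h with
  | some h => exact h
  | none => simp at hx

/-- Machines on top of related services, with related stored values, behave alike. -/
theorem machine_prob_eq {K K' : Interface} {V : S.Service K} {V' : S.Service K'} {O : System K}
    {O' : System K'} {VR : ∀ T, S.Dom T → S.Dom T → Prop} {HR : S.HashTable → S.HashTable → Prop}
    {RO : O.State → O'.State → Prop}
    (hpl : ∀ T, (∀ e, T ≠ .enc e) → ∀ v w, VR T v w ↔ v = w)
    (hempty : HR (fun _ _ => none) (fun _ _ => none))
    (heval : ∀ r ∈ S.rules, ∀ h h' x x', HR h h' → (∀ i, VR (r.inp i) (x i) (x' i)) →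
      Coupled (fun y y' => (∀ j, VR (r.out j) (y.1 j) (y'.1 j)) ∧ HR y.2 y'.2)
        (S.eval h r x) (S.eval h' r x'))
    (hinit : Coupled RO O.init O'.init)
    (henc : ∀ e v w o o', VR (.enc e) v w → RO o o' →
      Coupled (fun x y => x.1 = y.1 ∧ RO x.2 y.2)
        ((V.enc e v).runFrom O o) ((V'.enc e w).runFrom O' o'))
    (hchk : ∀ e c o o', RO o o' → Coupled (fun x y => RO x.2 y.2)
        ((V.chk e c).runFrom O o) ((V'.chk e c).runFrom O' o'))
    {D : S.E} {ι : Type} {d d' : ι → S.domE D} (hd : ∀ i, VR (.enc D) (d i) (d' i))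
    (hfree : ∀ e, ¬ S.OnLeakPath D e → ∀ v, VR (.enc e) v v) (A : Prog (S.advI D ι) Bool) :
    A.prob ((V.machine D d).onSystem O) true = A.prob ((V'.machine D d').onSystem O') true := by
  -- Related plaintexts receive the same ciphertext, so the new table entries sit at the same place
  -- and hold related values.
  have hemit : ∀ T v w, VR T v w → ∀ t o t' o', (TablesRel VR t t' ∧ RO o o') →
      Coupled (fun x y => x.1.1 = y.1.1 ∧ TablesRel VR x.1.2 y.1.2 ∧ RO x.2 y.2)
        ((V.emit T v t).runFrom O o) ((V'.emit T w t').runFrom O' o') := by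
    intro T v w hvw t o t' o' ht
    cases T with
    | enc e =>
      simp only [Service.emit, Prog.runFrom_bind]
      refine (henc e v w o o' hvw ht.2).bind fun x y hxy => Coupled.pure ⟨hxy.1, ?_, hxy.2⟩
      rw [hxy.1]
      intro e' c
      by_cases he : e' = e
      · subst he
        by_cases hc : c = y.1
        · subst hc; simp only [Function.update_self]; exact Option.Rel.some hvw
        · simpa [hc] using ht.1 e' c
      · simpa [he] using ht.1 e' c
    | _ => exact Coupled.pure ⟨(hpl _ (by simp) _ _).1 hvw, ht⟩
  have hcheck : ∀ T w u o u' o', RO o o' →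
      Coupled (fun x y => True ∧ RO x.2 y.2)
        ((V.check T w u).runFrom O o) ((V'.check T w u').runFrom O' o') := by
    intro T w u o u' o' ho
    cases T with
    | enc e =>
      simp only [Service.check, Prog.runFrom_bind]
      exact (hchk e w o o' ho).bind fun x y hxy => Coupled.pure ⟨trivial, hxy⟩
    | _ => exact Coupled.pure ⟨trivial, ho⟩
  refine Prog.prob_eq_of_coupled
    (R := fun (s : (S.HashTable × S.Tables) × O.State) (s' : (S.HashTable × S.Tables) × O'.State) =>
      HR s.1.1 s'.1.1 ∧ TablesRel VR s.1.2 s'.1.2 ∧ RO s.2 s'.2) ?_ ?_ A true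
  · refine (Coupled.pure
      (R := fun s s' : S.HashTable × S.Tables => HR s.1 s'.1 ∧ TablesRel VR s.2 s'.2)
      ⟨hempty, fun e c => Option.Rel.none⟩).bind fun s s' hs => ?_
    exact hinit.map fun o o' ho => ⟨hs.1, hs.2, ho⟩
  · rintro ⟨⟨h, t⟩, o⟩ ⟨⟨h', t'⟩, o'⟩ q ⟨hh, ht, ho⟩
    have hone : ∀ e v w, VR (.enc e) v w →
        Coupled (fun x y => x.1.1 = y.1.1 ∧ HR x.1.2.1 y.1.2.1 ∧ TablesRel VR x.1.2.2 y.1.2.2 ∧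
          RO x.2 y.2)
        (((V.emit (.enc e) v t).bind fun x => .ret (x.1, (h, x.2))).runFrom O o)
        (((V'.emit (.enc e) w t').bind fun x => .ret (x.1, (h', x.2))).runFrom O' o') := by
      intro e v w hvw
      simp only [Prog.runFrom_bind]
      exact (hemit _ v w hvw t o t' o' ⟨ht, ho⟩).bind
        fun x y hxy => Coupled.pure ⟨hxy.1, hh, hxy.2.1, hxy.2.2⟩
    have hcall : ∀ r ∈ S.rules, ∀ args,
        Coupled (fun x y => x.1.1 = y.1.1 ∧ HR x.1.2.1 y.1.2.1 ∧ TablesRel VR x.1.2.2 y.1.2.2 ∧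
          RO x.2 y.2)
        (((Prog.traverse (fun i => V.check (r.inp i) (args i)) ()).bind fun _ =>
          V.call (h, t) r args).runFrom O o)
        (((Prog.traverse (fun i => V'.check (r.inp i) (args i)) ()).bind fun _ =>
          V'.call (h', t') r args).runFrom O' o') := by
      intro r hr args
      rw [Prog.runFrom_bind, Prog.runFrom_bind]
      refine (Prog.traverse_coupled (Rv := fun _ _ _ => True) (R := fun _ o _ o' => RO o o')
        (fun i s o s' o' ho => hcheck (r.inp i) (args i) s o s' o' ho)
        () o () o' ho).bind fun x y hxy => ?_
      -- Both tables have the same ciphertexts, so the two machines reject in the same cases.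
      have hl := fun i => lookup_rel hpl ht (r.inp i) (args i)
      unfold Service.call
      by_cases hx : ∀ i, (lookup t (r.inp i) (args i)).isSome
      · have hx' : ∀ i, (lookup t' (r.inp i) (args i)).isSome := fun i =>
          (hl i).isSome_eq ▸ hx i
        rw [dif_pos hx, dif_pos hx']
        refine (heval r hr h h' _ _ hh fun i => (hl i).get (hx i) (hx' i)).bind fun u u' hu => ?_
        simp only [Prog.runFrom_bind]
        refine (Prog.traverse_coupled (Rv := fun j a b => a = b)
          (R := fun t o t' o' => TablesRel VR t t' ∧ RO o o')
          (fun j s o s' o' hs => hemit (r.out j) _ _ (hu.1 j) s o s' o' hs)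
          t _ t' _ ⟨ht, hxy.2⟩).bind
          fun w w' hw => Coupled.pure ⟨?_, hu.2, hw.2.1, hw.2.2⟩
        exact congrArg some (funext hw.1)
      · have hx' : ¬ ∀ i, (lookup t' (r.inp i) (args i)).isSome := fun hx' =>
          hx fun i => (hl i).isSome_eq ▸ hx' i
        rw [dif_neg hx, dif_neg hx']
        exact Coupled.pure ⟨rfl, hh, ht, hxy.2⟩
    obtain i | ⟨e, he, v⟩ | ⟨r, hr, args⟩ := q
    · exact (hone D _ _ (hd i)).map fun x y hxy => hxy
    · exact (hone e _ _ (hfree e he v)).map fun x y hxy => hxy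
    · exact (hcall r hr args).map fun x y hxy => hxy

end Schema

namespace Schema

variable {S : Schema}

/-! ## The integrity and the left-or-right experiments of all encrypted types together -/

/-- The integrity experiments of all encrypted types. -/
abbrev ctxtPi (S : Schema) : System (piI fun e => (S.scheme e).ctxtI) :=
  piSystem (St := fun e => (S.scheme e).Key × List (S.scheme e).Cipher × Bool)
    ((PMF.uniformOfFintype S.Keys).map fun k e => (k e, [], false))
    fun e => (S.scheme e).ctxtSystem.step

/-- Encryption and verification by the integrity experiments. -/
def ctxtService (S : Schema) : S.Service (piI fun e => (S.scheme e).ctxtI) where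
  enc := fun e v => .ask ⟨e, .inl v⟩ fun c => .ret c
  chk := fun e c => .ask ⟨e, .inr c⟩ fun _ => .ret ()

/-- The left-or-right experiments of all encrypted types. -/
abbrev cpaPi (S : Schema) (β : S.E → Bool) : System (piI fun e => (S.scheme e).cpaI) :=
  piSystem (St := fun e => (S.scheme e).Key) (PMF.uniformOfFintype S.Keys)
    fun e => ((S.scheme e).cpaSystem (β e)).step

/-- Encryption of either a value or its replacement. -/
def cpaService (S : Schema) (φ : ∀ e, S.domE e → S.domE e) :
    S.Service (piI fun e => (S.scheme e).cpaI) where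
  enc := fun e v => .ask ⟨e, (v, φ e v)⟩ fun c => .ret c
  chk := fun _ _ => .ret ()

theorem ctxtService_runFrom_enc (e : S.E) (v : S.domE e) (o : S.ctxtPi.State) :
    (S.ctxtService.enc e v).runFrom S.ctxtPi o = ((S.scheme e).enc (o e).1 v).map fun c =>
      (c, Function.update o e ((o e).1, c :: (o e).2.1, (o e).2.2)) := by
  change PMF.map _ (PMF.map _ (PMF.map _ _)) = _
  refine (congrArg _ (PMF.map_comp _ _ _)).trans ((PMF.map_comp _ _ _).trans ?_)
  rfl

theorem ctxtService_runFrom_chk (e : S.E) (c : (S.scheme e).Cipher) (o : S.ctxtPi.State) :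
    (S.ctxtService.chk e c).runFrom S.ctxtPi o = PMF.pure ((), Function.update o e
      ((o e).1, (o e).2.1, (o e).2.2 ||
        (((S.scheme e).dec (o e).1 c).isSome && decide (c ∉ (o e).2.1)))) := by
  change PMF.bind (PMF.bind (PMF.pure _) _) _ = _
  rw [PMF.pure_bind]
  exact (PMF.pure_bind _ _)

theorem cpaService_runFrom_enc (φ : ∀ e, S.domE e → S.domE e) (β : S.E → Bool) (e : S.E)
    (v : S.domE e) (k : S.Keys) :
    ((S.cpaService φ).enc e v).runFrom (S.cpaPi β) k =
      ((S.scheme e).enc (k e) (if β e then φ e v else v)).map fun c => (c, k) := by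
  change PMF.map _ (PMF.map _ (PMF.map _ _)) = _
  refine (congrArg _ (PMF.map_comp _ _ _)).trans ((PMF.map_comp _ _ _).trans ?_)
  refine congrArg (fun f => PMF.map f _) (funext fun c => ?_)
  exact congrArg (Prod.mk c) (Function.update_eq_self e k)

/-! ## From decryption to tables -/

/-- A forgery has been submitted. -/
def Forged (o : S.ctxtPi.State) : Prop := ∃ e, (o e).2.2 = true

theorem forged_step (o : S.ctxtPi.State) (q : (piI fun e => (S.scheme e).ctxtI).Q)
    (ho : S.Forged o) : ∀ x ∈ (S.ctxtPi.step o q).support, S.Forged x.2 := by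
  obtain ⟨e, he⟩ := ho
  obtain ⟨e', v | c⟩ := q
  · intro x hx
    obtain ⟨y, hy, rfl⟩ := (PMF.mem_support_map_iff _ _ _).1 hx
    obtain ⟨c, -, rfl⟩ := (PMF.mem_support_map_iff _ _ _).1 hy
    refine ⟨e, ?_⟩
    by_cases h : e = e'
    · subst h; simpa using he
    · simpa [h] using he
  · intro x hx
    have hx : x ∈ (PMF.map _ (PMF.pure _)).support := hx
    rw [PMF.support_map, PMF.support_pure, Set.image_singleton, Set.mem_singleton_iff] at hx
    subst hx
    refine ⟨e, ?_⟩
    by_cases h : e = e'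
    · subst h; simp [he]
    · simpa [h] using he

/-- The tables and the integrity experiments describe the keys `k`. -/
def Consistent (k : S.Keys) (t : S.Tables) (o : S.ctxtPi.State) : Prop :=
  ∀ e, (o e).1 = k e ∧ (∀ c, c ∈ (o e).2.1 ↔ (t e c).isSome) ∧
    ∀ c v, t e c = some v → (S.scheme e).dec (k e) c = some v

/-- The same ciphertext is drawn on both sides. Correctness of the scheme on the support of `enc`
makes the new table entry agree with decryption, even if the ciphertext had been issued before. -/
theorem emit_coupled (k : S.Keys) (T : Ty S.P S.E) (v : S.Dom T) (t : S.Tables)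
    (o : S.ctxtPi.State) (h : Consistent k t o) :
    Coupled (fun x y => x = y.1.1 ∧ Consistent k y.1.2 y.2)
      (S.encode k T v) ((S.ctxtService.emit T v t).runFrom S.ctxtPi o) := by
  cases T with
  | enc e =>
    suffices hv : ∀ v : S.domE e, Coupled (fun x y => x = y.1.1 ∧ Consistent k y.1.2 y.2)
        (((S.scheme e).enc (k e) v).map id) (((S.ctxtService.enc e v).bind fun c =>
          .ret (c, Function.update t e (Function.update (t e) c (some v)))).runFrom S.ctxtPi o) by
      have hv := hv v
      rw [PMF.map_id] at hv
      exact hv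
    clear v
    intro v
    rw [Prog.runFrom_bind, ctxtService_runFrom_enc, PMF.bind_map, (h e).1]
    refine Coupled.map_same ((S.scheme e).enc (k e) v) _ _ fun c hc => ⟨rfl, fun e' => ?_⟩
    by_cases he : e' = e
    · subst he
      simp only [Function.update_self]
      refine ⟨trivial, fun c' => ?_, fun c' v' => ?_⟩
      · by_cases hc' : c' = c
        · simp [hc']
        · simpa [hc'] using (h e').2.1 c'
      · by_cases hc' : c' = c
        · subst hc'
          simp only [Function.update_self, Option.some.injEq]
          rintro rfl
          exact (S.scheme e').correct _ _ _ hc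
        · simpa [hc'] using (h e').2.2 c' v'
    · simpa [he] using h e'
  | _ => exact Coupled.pure ⟨rfl, h⟩

theorem check_runFrom_enc (e : S.E) (c : (S.scheme e).Cipher) (u : Unit) (o : S.ctxtPi.State) :
    (S.ctxtService.check (.enc e) c u).runFrom S.ctxtPi o = PMF.pure (((), ()), Function.update o e
      ((o e).1, (o e).2.1, (o e).2.2 ||
        (((S.scheme e).dec (o e).1 c).isSome && decide (c ∉ (o e).2.1)))) := by
  change ((S.ctxtService.chk e c).bind fun _ => .ret ((), ())).runFrom S.ctxtPi o = _
  rw [Prog.runFrom_bind, ctxtService_runFrom_chk, PMF.pure_bind]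
  rfl

/-- Verification is deterministic and changes nothing but the forgery flag. If no flag is up, lookup
equals decryption: an issued ciphertext decrypts to its table entry, and one that was not issued
must be invalid, or else it would have raised the flag. -/
theorem check_run (T : Ty S.P S.E) (w : S.Wire T) (u : Unit) (k : S.Keys) (t : S.Tables)
    (o : S.ctxtPi.State) (h : Consistent k t o) :
    ∃ o', (S.ctxtService.check T w u).runFrom S.ctxtPi o = PMF.pure (((), ()), o') ∧
      Consistent k t o' ∧ (S.Forged o → S.Forged o') ∧
        (S.Forged o' ∨ lookup t T w = S.decode k T w) := by
  cases T with
  | enc e =>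
    revert w
    intro (w : (S.scheme e).Cipher)
    refine ⟨_, check_runFrom_enc e w u o, fun e' => ?_, ?_, ?_⟩
    · by_cases he : e' = e
      · subst he; simpa using h e'
      · simpa [he] using h e'
    · rintro ⟨e', he'⟩
      refine ⟨e', ?_⟩
      by_cases he : e' = e
      · subst he; simp [he']
      · simpa [he] using he'
    · rw [or_iff_not_imp_left]
      intro hf
      have hf : ¬ (((S.scheme e).dec (o e).1 w).isSome && decide (w ∉ (o e).2.1)) = true := by
        intro h'
        exact hf ⟨e, by simp only [Function.update_self]; rw [h', Bool.or_true]⟩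
      obtain ⟨h1, h2, h3⟩ := h e
      change t e w = (S.scheme e).dec (k e) w
      cases ht : t e w with
      | some v => exact (h3 w v ht).symm
      | none =>
        have : w ∉ (o e).2.1 := by rw [h2, ht]; simp
        rw [h1] at hf
        exact Eq.symm (by simpa [this] using hf)
  | _ => exact ⟨o, rfl, h, id, Or.inr rfl⟩

theorem checks_run {n : ℕ} (T : Fin n → Ty S.P S.E) (w : ∀ i, S.Wire (T i)) (k : S.Keys)
    (t : S.Tables) (o : S.ctxtPi.State) (h : Consistent k t o) :
    ∃ x o', (Prog.traverse (fun i => S.ctxtService.check (T i) (w i)) ()).runFrom S.ctxtPi o =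
      PMF.pure (x, o') ∧ Consistent k t o' ∧ (S.Forged o → S.Forged o') ∧
        (S.Forged o' ∨ ∀ i, lookup t (T i) (w i) = S.decode k (T i) (w i)) := by
  induction n generalizing o with
  | zero => exact ⟨_, o, rfl, h, id, Or.inr fun i => i.elim0⟩
  | succ n ih =>
    obtain ⟨o₁, h1, h2, h3, h4⟩ := check_run (T 0) (w 0) () k t o h
    obtain ⟨x, o₂, g1, g2, g3, g4⟩ := ih (fun i => T i.succ) (fun i => w i.succ) o₁ h2
    refine ⟨(Fin.cons () x.1, x.2), o₂, ?_, g2, g3 ∘ h3, ?_⟩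
    · simp only [Prog.traverse, Prog.runFrom_bind, h1, PMF.pure_bind, g1]
      rfl
    · rcases h4 with h4 | h4
      · exact Or.inl (g3 h4)
      · exact g4.imp_right fun g i => Fin.cases h4 g i

/-- All inputs are verified before any of them is used. Hence either a forgery is already on record,
or lookup and decryption agree on every input and the two machines evaluate the same values. -/
theorem call_coupled (k : S.Keys) (h : S.HashTable) (t : S.Tables) (o : S.ctxtPi.State)
    (hc : Consistent k t o) (r : Rule S.toTypeSystem) (args : ∀ i, S.Wire (r.inp i)) :
    Coupled (fun x y => S.Forged y.2 ∨ (x.1 = y.1.1 ∧ x.2 = y.1.2.1 ∧ Consistent k y.1.2.2 y.2))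
      (S.tmCall k h r args)
      (((Prog.traverse (fun i => S.ctxtService.check (r.inp i) (args i)) ()).bind fun _ =>
        S.ctxtService.call (h, t) r args).runFrom S.ctxtPi o) := by
  obtain ⟨x, o', h1, h2, h3, h4⟩ := checks_run r.inp args k t o hc
  rw [Prog.runFrom_bind, h1, PMF.pure_bind]
  rcases h4 with h4 | h4
  · exact Coupled.of_snd _ _ fun _ y hy => Or.inl (Prog.runFrom_preserves forged_step _ _ h4 y hy)
  · refine Coupled.mono (R := fun x y => x.1 = y.1.1 ∧ x.2 = y.1.2.1 ∧ Consistent k y.1.2.2 y.2) ?_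
      fun x y => Or.inr
    unfold Service.call tmCall
    simp only [h4]
    split_ifs with hx
    · simp only [Prog.runFrom, Prog.runFrom_bind]
      refine (Coupled.refl (R := Eq) _ fun _ _ => rfl).bind fun y y' hy => ?_
      subst hy
      refine (Prog.pmfPi_coupled (Rv := fun j a b => a = b) (R := fun t o => Consistent k t o)
        (fun j t o ht => emit_coupled k (r.out j) (y.1 j) t o ht) t o' h2).bind
        fun w w' hw => Coupled.pure ⟨?_, rfl, hw.2⟩
      exact congrArg some (funext hw.1)
    · exact Coupled.pure ⟨rfl, rfl, h2⟩

/-- Consistency of keys, tables and issued ciphertexts is the invariant, and a recorded forgery is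
the bad event. -/
theorem world_coupled {D : S.E} {ι : Type} (d : ι → S.domE D) (A : Prog (S.advI D ι) Bool) :
    Coupled (fun x y => S.Forged y.2.2 ∨ x.1 = y.1) (A.run (S.world D d))
      (A.run ((S.ctxtService.machine D d).onSystem S.ctxtPi)) := by
  refine Coupled.mono (Prog.run_coupled (O := S.world D d)
    (O' := (S.ctxtService.machine D d).onSystem S.ctxtPi)
    (R := fun (s : S.Keys × S.HashTable) (s' : (S.HashTable × S.Tables) × S.ctxtPi.State) =>
      s.2 = s'.1.1 ∧ Consistent s.1 s'.1.2 s'.2)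
    (bad := fun s' => S.Forged s'.2) ?_ ?_ ?_ A) fun x y h => h.imp_right And.left
  · intro s q hs x hx
    have hx : x ∈ (PMF.map _ _).support := hx
    rw [PMF.support_map] at hx
    obtain ⟨y, hy, rfl⟩ := hx
    exact Prog.runFrom_preserves forged_step _ _ hs y hy
  · have hinit : ((S.ctxtService.machine D d).onSystem S.ctxtPi).init =
        (PMF.uniformOfFintype S.Keys).map fun k =>
          ((fun _ _ => none, fun _ _ => none), fun e => (k e, [], false)) :=
      (PMF.pure_bind (fun _ _ => none, fun _ _ => none) _).trans (PMF.map_comp _ _ _)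
    refine (congrArg (Coupled _ _) hinit).mpr ?_
    refine Coupled.map_same _ _ _ fun k _ => ⟨rfl, fun e => ⟨rfl, ?_, ?_⟩⟩
    · simp
    · simp
  · rintro ⟨k, h⟩ ⟨⟨h', t⟩, o⟩ q ⟨rfl, hc⟩
    have hone : ∀ e v, Coupled (fun x y => x = y.1.1 ∧ h = y.1.2.1 ∧ Consistent k y.1.2.2 y.2)
        ((S.scheme e).enc (k e) v)
        (((S.ctxtService.emit (.enc e) v t).bind fun x => .ret (x.1, (h, x.2))).runFrom
          S.ctxtPi o) := by
      intro e v
      rw [Prog.runFrom_bind, ← PMF.bind_pure ((S.scheme e).enc (k e) v)]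
      exact (emit_coupled k (.enc e) v t o hc).bind fun x y hxy =>
        Coupled.pure ⟨hxy.1, rfl, hxy.2⟩
    obtain i | ⟨e, he, v⟩ | ⟨r, hr, args⟩ := q
    · exact (hone D (d i)).map fun x y hxy => Or.inr hxy
    · exact (hone e v).map fun x y hxy => Or.inr hxy
    · exact (call_coupled k h t o hc r args).map fun x y hxy => hxy

/-- The reduction to the integrity of the encryption of type `e`. -/
def ctxtReduction {D : S.E} {ι : Type} (d : ι → S.domE D) (e : S.E) :
    Emulator (S.advI D ι) (S.scheme e).ctxtI :=
  (S.ctxtService.machine D d).comp (isolate (S.ctxtPi).init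
    (St := fun e => (S.scheme e).Key × List (S.scheme e).Cipher × Bool)
    (fun e => (S.scheme e).ctxtSystem.step) e)

/-- The reduction emulates the experiments of all other types itself, so its oracle's flag has the
law of the flag of `e` in the joint system. -/
theorem ctxtAdv_ctxtReduction {D : S.E} {ι : Type} (d : ι → S.domE D) (e : S.E)
    (A : Prog (S.advI D ι) Bool) :
    (S.scheme e).ctxtAdv ((ctxtReduction d e).apply A) =
      ((A.run ((S.ctxtService.machine D d).onSystem S.ctxtPi)).toOuterMeasure
        {y | (y.2.2 e).2.2 = true}).toReal := by
  have h := run_apply_comp_isolate (S.ctxtService.machine D d)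
    (St := fun e => (S.scheme e).Key × List (S.scheme e).Cipher × Bool)
    (ini := (PMF.uniformOfFintype S.Keys).map fun k e => (k e, [], false))
    (stp := fun e => (S.scheme e).ctxtSystem.step)
    (stp' := fun e => (S.scheme e).ctxtSystem.step)
    (inie := (PMF.uniformOfFintype (S.scheme e).Key).map fun k => (k, [], false)) (e := e)
    (uniform_map_bind_update (fun e => (S.scheme e).Key)
      (St := fun e => (S.scheme e).Key × List (S.scheme e).Cipher × Bool)
      (fun e k => (k, [], false)) e) (fun _ _ => rfl) A
  unfold SymEnc.ctxtAdv
  have h' : ((ctxtReduction d e).apply A).run (S.scheme e).ctxtSystem = _ := h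
  rw [h']
  exact congrArg ENNReal.toReal ((DFunLike.congr_fun (PMF.map_comp _ _ _) true).trans
    ((PMF.toOuterMeasure_apply_singleton _ _).symm.trans (PMF.toOuterMeasure_map_apply _ _ _)))

theorem abs_world_sub_ctxtMachine_le {D : S.E} {ι : Type} (d : ι → S.domE D)
    (A : Prog (S.advI D ι) Bool) :
    |A.prob (S.world D d) true - A.prob ((S.ctxtService.machine D d).onSystem S.ctxtPi) true| ≤
      ∑ e, (S.scheme e).ctxtAdv ((ctxtReduction d e).apply A) := by
  refine ((world_coupled d A).abs_sub_le true).trans ?_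
  simp only [ctxtAdv_ctxtReduction]
  set p := A.run ((S.ctxtService.machine D d).onSystem S.ctxtPi)
  have fin : ∀ s, p.toOuterMeasure s ≠ ⊤ := fun s => by
    refine ne_top_of_le_ne_top ENNReal.one_ne_top ?_
    rw [← (PMF.toOuterMeasure_apply_eq_one_iff (p := p) (s := Set.univ)).2 (Set.subset_univ _)]
    exact p.toOuterMeasure.mono (Set.subset_univ _)
  rw [← ENNReal.toReal_sum fun e _ => fin _]
  refine ENNReal.toReal_mono (ENNReal.sum_ne_top.2 fun e _ => fin _) ?_
  -- Union bound over the finitely many encrypted types.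
  have : {y | S.Forged y.2.2} = ⋃ e, {y : Bool × ((S.HashTable × S.Tables) × S.ctxtPi.State) |
      (y.2.2 e).2.2 = true} := by
    ext y; simp [Forged]
  refine (le_of_eq (congrArg _ this)).trans ?_
  exact MeasureTheory.measure_iUnion_fintype_le _ _

/-! ## From real to replaced plaintexts -/

/-- The answers to verification queries are discarded by the machine, so the integrity experiments
act as mere encryption oracles, just like left-or-right oracles that always take the left message.
-/
theorem ctxtMachine_prob_eq (φ : ∀ e, S.domE e → S.domE e) {D : S.E} {ι : Type} (d : ι → S.domE D)
    (A : Prog (S.advI D ι) Bool) :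
    A.prob ((S.ctxtService.machine D d).onSystem S.ctxtPi) true =
      A.prob (((S.cpaService φ).machine D d).onSystem (S.cpaPi fun _ => false)) true := by
  refine machine_prob_eq (VR := fun _ => Eq) (HR := Eq)
    (RO := fun (o : S.ctxtPi.State) (k : S.Keys) => ∀ e, (o e).1 = k e)
    (fun _ _ _ _ => Iff.rfl) rfl ?_ ?_ ?_ ?_
    (fun _ => rfl) (fun _ _ _ => rfl) A
  · rintro r hr h _ x x' rfl hx
    obtain rfl : x = x' := funext hx
    exact Coupled.refl _ fun _ _ => ⟨fun _ => rfl, rfl⟩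
  · change Coupled _ (PMF.map _ _) (PMF.uniformOfFintype S.Keys)
    rw [← PMF.map_id (PMF.uniformOfFintype S.Keys)]
    conv in PMF.map _ (PMF.map id _) => rw [PMF.map_id]
    exact Coupled.map_same _ _ _ fun k _ e => rfl
  · suffices hv : ∀ e (v : S.domE e) (o : S.ctxtPi.State) (k : S.Keys), (∀ e, (o e).1 = k e) →
        Coupled (fun x y => x.1 = y.1 ∧ ∀ e, (x.2 e).1 = y.2 e)
          ((S.ctxtService.enc e v).runFrom S.ctxtPi o)
          (((S.cpaService φ).enc e v).runFrom (S.cpaPi fun _ => false) k) by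
      rintro e v _ o k rfl ho
      exact hv e v o k ho
    intro e v o k ho
    rw [ctxtService_runFrom_enc, cpaService_runFrom_enc, ho e]
    refine Coupled.map_same _ _ _ fun c _ => ⟨rfl, fun e' => ?_⟩
    by_cases he : e' = e
    · subst he; simp
    · simpa [he] using ho e'
  · intro e c o k ho
    rw [ctxtService_runFrom_chk]
    refine Coupled.pure fun e' => ?_
    by_cases he : e' = e
    · subst he; simpa using ho e'
    · simpa [he] using ho _

/-- The position of an encrypted type in a fixed enumeration. -/
def index (e : S.E) : ℕ := (Fintype.equivFin S.E e : ℕ)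

/-- The hybrid in which the values of the first `n` encrypted types are replaced. -/
def hybrid (S : Schema) (n : ℕ) (e : S.E) : Bool := decide (S.index e < n)

/-- The reduction to the secrecy of the encryption of type `e`. -/
def cpaReduction (φ : ∀ e, S.domE e → S.domE e) {D : S.E} {ι : Type} (d : ι → S.domE D) (e : S.E) :
    Emulator (S.advI D ι) (S.scheme e).cpaI :=
  ((S.cpaService φ).machine D d).comp (isolate (PMF.uniformOfFintype S.Keys)
    (fun e' => ((S.scheme e').cpaSystem (S.hybrid (S.index e) e')).step) e)

theorem prob_cpaReduction (φ : ∀ e, S.domE e → S.domE e) {D : S.E} {ι : Type} (d : ι → S.domE D)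
    (e : S.E) (β : S.E → Bool) (hβ : ∀ e', e ≠ e' → S.hybrid (S.index e) e' = β e')
    (A : Prog (S.advI D ι) Bool) :
    ((cpaReduction φ d e).apply A).prob ((S.scheme e).cpaSystem (β e)) true =
      A.prob (((S.cpaService φ).machine D d).onSystem (S.cpaPi β)) true := by
  have h := run_apply_comp_isolate ((S.cpaService φ).machine D d)
    (St := fun e => (S.scheme e).Key)
    (ini := PMF.uniformOfFintype S.Keys)
    (stp := fun e' => ((S.scheme e').cpaSystem (S.hybrid (S.index e) e')).step)
    (stp' := fun e' => ((S.scheme e').cpaSystem (β e')).step)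
    (inie := PMF.uniformOfFintype (S.scheme e).Key) (e := e)
    (uniform_bind_update (fun e => (S.scheme e).Key) e) (fun e' he' => by rw [hβ e' he']) A
  have h' : ((cpaReduction φ d e).apply A).run ((S.scheme e).cpaSystem (β e)) = _ := h
  unfold Prog.prob
  rw [h']
  exact congrArg ENNReal.toReal (DFunLike.congr_fun (PMF.map_comp _ _ _) true)

/-- The hybrids at `index e` and `index e + 1` differ only in the bit of `e`, which is the bit of
the isolated oracle. -/
theorem cpaAdv_cpaReduction (φ : ∀ e, S.domE e → S.domE e) {D : S.E} {ι : Type} (d : ι → S.domE D)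
    (e : S.E) (A : Prog (S.advI D ι) Bool) :
    (S.scheme e).cpaAdv ((cpaReduction φ d e).apply A) =
      |A.prob (((S.cpaService φ).machine D d).onSystem (S.cpaPi (S.hybrid (S.index e + 1)))) true -
        A.prob (((S.cpaService φ).machine D d).onSystem (S.cpaPi (S.hybrid (S.index e))))
          true| := by
  rw [← prob_cpaReduction φ d e _ (fun _ _ => rfl) A,
    ← prob_cpaReduction φ d e (S.hybrid (S.index e + 1)) (fun e' he => ?_) A]
  · simp [SymEnc.cpaAdv, hybrid]
  · have : S.index e ≠ S.index e' := fun h =>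
      he ((Fintype.equivFin S.E).injective (Fin.ext h))
    simp only [hybrid, decide_eq_decide]
    omega

/-- Telescoping over the hybrids, one encrypted type per step. -/
theorem abs_cpaMachine_sub_le (φ : ∀ e, S.domE e → S.domE e) {D : S.E} {ι : Type}
    (d : ι → S.domE D) (A : Prog (S.advI D ι) Bool) :
    |A.prob (((S.cpaService φ).machine D d).onSystem (S.cpaPi fun _ => false)) true -
      A.prob (((S.cpaService φ).machine D d).onSystem (S.cpaPi fun _ => true)) true| ≤
      ∑ e, (S.scheme e).cpaAdv ((cpaReduction φ d e).apply A) := by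
  set P : ℕ → ℝ := fun n =>
    A.prob (((S.cpaService φ).machine D d).onSystem (S.cpaPi (S.hybrid n))) true with hP
  have h0 : S.hybrid 0 = fun _ => false := by funext e; simp [hybrid]
  have h1 : S.hybrid (Fintype.card S.E) = fun _ => true := by
    funext e; simp [hybrid, index]
  have hsum : ∑ e, (S.scheme e).cpaAdv ((cpaReduction φ d e).apply A) =
      ∑ n ∈ Finset.range (Fintype.card S.E), |P (n + 1) - P n| := by
    rw [Finset.sum_range fun n => |P (n + 1) - P n|]
    refine Fintype.sum_equiv (Fintype.equivFin S.E) _ _ fun e => ?_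
    exact cpaAdv_cpaReduction φ d e A
  rw [hsum, ← h0, ← h1, abs_sub_comm]
  change |P _ - P _| ≤ _
  rw [← Finset.sum_range_sub]
  exact Finset.abs_sum_le_sum_abs _ _

/-- Worlds whose versions with tables and replaced plaintexts agree are indistinguishable. -/
theorem indist_of_cpaMachine_eq {a : ℕ} (ha : 1 ≤ a) (hSa : S.ArityLE a)
    (φ : ∀ e, S.domE e → S.domE e) {D : S.E} {ι : Type} (d₀ d₁ : ι → S.domE D)
    (h : ∀ A : Prog (S.advI D ι) Bool,
      A.prob (((S.cpaService φ).machine D d₀).onSystem (S.cpaPi fun _ => true)) true =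
      A.prob (((S.cpaService φ).machine D d₁).onSystem (S.cpaPi fun _ => true)) true) :
    S.Indist a (S.world D d₀) (S.world D d₁) := by
  refine ⟨fun b e => cpaReduction φ (if b then d₁ else d₀) e,
    fun b e => ctxtReduction (if b then d₁ else d₀) e, fun b e => ⟨?_, ?_⟩, fun A => ?_⟩
  -- In the left-or-right reduction checks are free.
  · have := Service.machine_cost (V := S.cpaService φ) (c := 0) ha hSa
      (fun _ _ _ => trivial) (fun _ _ => trivial) (if b then d₁ else d₀)
    rw [mul_zero, zero_add] at this
    exact this.comp (isolate_cost _ _ _)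
  -- Here each check costs one verification query, whence the factor two.
  · have := Service.machine_cost (V := S.ctxtService) (c := 1) ha hSa
      (fun _ _ _ => trivial) (fun _ _ _ => trivial) (if b then d₁ else d₀)
    rw [mul_one, ← two_mul] at this
    exact this.comp (isolate_cost _ _ _)
  · have hb : ∀ d : ι → S.domE D, |A.prob (S.world D d) true -
        A.prob (((S.cpaService φ).machine D d).onSystem (S.cpaPi fun _ => true)) true| ≤
        ∑ e, ((S.scheme e).cpaAdv ((cpaReduction φ d e).apply A) +
          (S.scheme e).ctxtAdv ((ctxtReduction d e).apply A)) := by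
      intro d
      rw [Finset.sum_add_distrib]
      have h1 := abs_world_sub_ctxtMachine_le d A
      have h2 := abs_cpaMachine_sub_le φ d A
      rw [← ctxtMachine_prob_eq φ d A] at h2
      refine (abs_sub_le _ _ _).trans ((add_le_add h1 h2).trans (le_of_eq (add_comm _ _)))
    rw [Fintype.sum_bool]
    simp only [if_true, Bool.false_eq_true, if_false]
    have h0 := hb d₀
    have h1 := hb d₁
    -- The two masked machines have the same output probability, which serves as the middle term of
    -- a triangle inequality.
    rw [← h A, abs_sub_comm] at h1
    refine (abs_sub_le _ _ _).trans ((add_le_add h0 h1).trans (le_of_eq (add_comm _ _)))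

end Schema

/-- The function of a rule, if it is neither `equal` nor `hash`. -/
def Rule.fun? {S : TypeSystem} : (r : Rule S) → (∀ i, S.Dom (r.inp i)) →
    Option (∀ j, S.Dom (r.out j))
  | .fn _ _ _ _ f, x => some (f x)
  | .equal _, _ => none
  | .hash _, _ => none

/-- Injectivity concerns the whole input tuple: the first output alone determines all inputs. -/
theorem Rule.IsInjective.eq_of_fun? {S : TypeSystem} {r : Rule S} (h : r.IsInjective)
    {j : Fin r.nOut}
    (hj : j.val = 0) {x y : ∀ i, S.Dom (r.inp i)} {u v : ∀ j, S.Dom (r.out j)}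
    (hu : r.fun? x = some u) (hv : r.fun? y = some v) (huv : u j = v j) : x = y := by
  cases r with
  | fn n m inp out f =>
    obtain ⟨h0, hinj⟩ := h
    obtain rfl : j = ⟨0, h0⟩ := Fin.ext hj
    obtain rfl : f x = u := Option.some.inj hu
    obtain rfl : f y = v := Option.some.inj hv
    exact hinj huv
  | equal T => exact h.elim
  | hash T => exact h.elim

namespace Schema

variable {S : Schema}

/-! ## The information flow graph -/

/-- There is a nontrivial path to `boolean` or `hashDom`. -/
def Leaks (S : Schema) (T : Ty S.P S.E) : Prop :=
  ∃ B : Ty S.P S.E, (B = .boolean ∨ B = .hashDom) ∧ ∃ r : S.Walk T B, 0 < r.length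

/-- A rule as an edge of the information flow graph. -/
def ruleEdge {r : Rule S.toTypeSystem} (hr : r ∈ S.rules) (i : Fin r.nIn) (j : Fin r.nOut) :
    S.Edge (r.inp i) (r.out j) := ⟨r, hr, i, j, rfl, rfl⟩

/-- Prolonging a walk by an edge. -/
def Walk.snoc {a b c : Ty S.P S.E} (p : S.Walk a b) (e : S.Edge b c) : S.Walk a c :=
  @Quiver.Path.cons S.Vertex (flowGraph S) a b c p e

/-- Preceding a walk by an edge. -/
theorem Edge.leaks {a b : Ty S.P S.E} (e : S.Edge a b) (h : S.Leaks b) : S.Leaks a := by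
  obtain ⟨B, hB, r, hr⟩ := h
  exact ⟨B, hB, Quiver.Path.comp (Walk.snoc Quiver.Path.nil e) r,
    (Nat.add_pos_right _ hr).trans_eq (Quiver.Path.length_comp _ _).symm⟩

theorem Edge.leaks_of_tgt {a B : Ty S.P S.E} (e : S.Edge a B) (hB : B = .boolean ∨ B = .hashDom) :
    S.Leaks a :=
  ⟨B, hB, Walk.snoc Quiver.Path.nil e, Nat.succ_pos _⟩

theorem EndsWith.of_cons {final : Ty S.P S.E → Rule S.toTypeSystem} {a b c : S.Vertex}
    {p : Quiver.Path a b} {e : b ⟶ c} (h : S.EndsWith final (p.cons e)) :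
    S.IsInjChain p ∧ Edge.rule e = final b := by
  obtain ⟨T, q, e', h, hc, hr⟩ := h
  cases h
  exact ⟨hc, hr⟩

theorem IsInjChain.of_comp {a b c : S.Vertex} {p : Quiver.Path a b} {r : Quiver.Path b c}
    (h : S.IsInjChain (p.comp r)) : S.IsInjChain p := by
  induction r with
  | nil => exact h
  | cons r e ih => exact ih h.1

/-- Equality of two walks identifies their last edges only heterogeneously, as their sources are a
priori different types. -/
theorem Edge.i_eq_of_heq {a a' b : S.Vertex} (ha : a = a') {e : S.Edge a b} {e' : S.Edge a' b}
    (h : HEq e e') : (e.i : ℕ) = e'.i := by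
  subst ha
  rw [eq_of_heq h]

namespace IsDeterministic

variable {D : S.E}

/-- Prolonging the walk to `boolean` or `hashDom` gives a chain with one final edge. The
prolongation is nontrivial, so removing that edge leaves a chain of which the given walk is an
initial part. -/
theorem isInjChain (hD : S.IsDeterministic D) {T : Ty S.P S.E} (p : S.Walk (.enc D) T)
    (hT : S.Leaks T) : S.IsInjChain p := by
  obtain ⟨B, hB, r, hr⟩ := hT
  cases r with
  | nil => exact absurd hr (lt_irrefl 0)
  | cons r e =>
    rcases hB with rfl | rfl
    · exact (EndsWith.of_cons (hD.to_boolean ((Quiver.Path.comp p r).cons e))).1.of_comp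
    · exact (EndsWith.of_cons (hD.to_hashDom ((Quiver.Path.comp p r).cons e))).1.of_comp

theorem not_isInjChain_of_endsWith {final : Ty S.P S.E → Rule S.toTypeSystem}
    (hf : ∀ T, ¬ (final T).IsInjective) {a b : S.Vertex} {p : Quiver.Path a b}
    (h : S.EndsWith final p) : ¬ S.IsInjChain p := by
  obtain ⟨T, q, e, rfl, -, hr⟩ := h
  intro hc
  have := hc.2.1
  rw [hr] at this
  exact hf _ this

/-- A walk that reaches `boolean` or `hashDom` ends with `equal` or `hash`, which are not injective,
and so it cannot be continued to a leak. -/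
theorem exists_eq_enc (hD : S.IsDeterministic D) {T : Ty S.P S.E} (p : S.Walk (.enc D) T)
    (hT : S.Leaks T) : ∃ e, T = .enc e := by
  have hc := hD.isInjChain p hT
  cases T with
  | enc e => exact ⟨e, rfl⟩
  | plain t => exact ((hD.no_plain t).false p).elim
  | boolean =>
    exact (not_isInjChain_of_endsWith (final := Rule.equal) (fun _ h => h) (hD.to_boolean p) hc).elim
  | hashDom =>
    exact (not_isInjChain_of_endsWith (final := Rule.hash) (fun _ h => h) (hD.to_hashDom p) hc).elim

/-- Uniqueness of walks in the form used below: any rule that leads from a reachable type to a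
leaking one is the last edge of every walk there. -/
theorem walk_eq (hD : S.IsDeterministic D) {T T' : Ty S.P S.E} (q : S.Walk (.enc D) T)
    (e : S.Edge T T') (hT' : S.Leaks T') (p : S.Walk (.enc D) T') : p = q.snoc e := by
  obtain ⟨B, hB, r, hr⟩ := hT'
  exact hD.unique T' B (q.snoc e) r hB (Nat.succ_pos _) hr p

theorem walk_self_eq_nil (hD : S.IsDeterministic D) (h : S.Leaks (.enc D))
    (p : S.Walk (.enc D) (.enc D)) : p = Quiver.Path.nil := by
  obtain ⟨B, hB, r, hr⟩ := h
  by_cases hp : 0 < p.length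
  · exact (hD.unique _ B p r hB hp hr Quiver.Path.nil).symm
  · exact Quiver.Path.eq_nil_of_length_zero p (by omega)

/-- Only one input of a rule with a leaking output is reachable. -/
theorem input_eq (hD : S.IsDeterministic D) {r : Rule S.toTypeSystem} (hr : r ∈ S.rules)
    {j : Fin r.nOut} (hj : S.Leaks (r.out j)) {i i' : Fin r.nIn} (q : S.Walk (.enc D) (r.inp i))
    (q' : S.Walk (.enc D) (r.inp i')) : i' = i := by
  have h := hD.walk_eq q (ruleEdge hr i j) hj (q'.snoc (ruleEdge hr i' j))
  exact Fin.ext (Edge.i_eq_of_heq (Quiver.Path.obj_eq_of_cons_eq_cons h)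
    (Quiver.Path.hom_heq_of_cons_eq_cons h))

theorem onLeakPath {e : S.E} (p : S.Walk (.enc D) (.enc e)) (h : S.Leaks (.enc e)) :
    S.OnLeakPath D e := by
  obtain ⟨B, rfl | rfl, r, -⟩ := h
  · exact ⟨⟨p⟩, Or.inl ⟨r⟩⟩
  · exact ⟨⟨p⟩, Or.inr ⟨r⟩⟩

/-- The outputs of a function rule with a reachable input are not plaintext. -/
theorem out_ne (hD : S.IsDeterministic D) {n m : ℕ} {inp : Fin n → Ty S.P S.E}
    {out : Fin m → Ty S.P S.E} {f : (∀ i, S.Dom (inp i)) → ∀ j, S.Dom (out j)}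
    (hr : Rule.fn n m inp out f ∈ S.rules) {i : Fin n} (q : S.Walk (.enc D) (inp i)) (j : Fin m) :
    ∃ e, out j = .enc e := by
  cases hT : out j with
  | enc e => exact ⟨e, rfl⟩
  | plain t =>
    exact ((hD.no_plain t).false (q.snoc ⟨Rule.fn n m inp out f, hr, i, j, rfl, hT⟩)).elim
  | boolean =>
    have := (EndsWith.of_cons
      (hD.to_boolean (q.snoc ⟨Rule.fn n m inp out f, hr, i, j, rfl, hT⟩))).2
    exact absurd this (by simp)
  | hashDom =>
    have := (EndsWith.of_cons
      (hD.to_hashDom (q.snoc ⟨Rule.fn n m inp out f, hr, i, j, rfl, hT⟩))).2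
    exact absurd this (by simp)

end IsDeterministic

/-! ## Values with the same history -/

section ValRel

variable {D : S.E} {ι : Type} (d₀ d₁ : ι → S.domE D)

/-- The values arise, by the functions along the path, from the same stored value and from the
same further inputs. -/
def SameHistory : {T : S.Vertex} → @Quiver.Path S.Vertex (flowGraph S) (Ty.enc D) T →
    S.Dom T → S.Dom T → Prop
  | _, .nil, v, w => ∃ i, v = d₀ i ∧ w = d₁ i
  | _, .cons p e, v, w => ∃ (x y : ∀ i, S.Dom ((Edge.rule e).inp i))
      (u u' : ∀ j, S.Dom ((Edge.rule e).out j)),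
      (∀ i, i ≠ Edge.i e → x i = y i) ∧
      SameHistory p (cast (congrArg S.Dom (Edge.src e)) (x (Edge.i e)))
        (cast (congrArg S.Dom (Edge.src e)) (y (Edge.i e))) ∧
      (Edge.rule e).fun? x = some u ∧ (Edge.rule e).fun? y = some u' ∧
      v = cast (congrArg S.Dom (Edge.tgt e)) (u (Edge.j e)) ∧
      w = cast (congrArg S.Dom (Edge.tgt e)) (u' (Edge.j e))

variable {d₀ d₁}

/-- Induction along the walk. Equal outputs on one side force equal input tuples there by
injectivity. The side inputs are common to both sides and the main inputs are handled by the
induction hypothesis, so the tuples, and with them the outputs, are equal on the other side too. -/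
theorem SameHistory.eq_iff (hd : ∀ i j, d₀ i = d₀ j ↔ d₁ i = d₁ j) {T : S.Vertex}
    {p : @Quiver.Path S.Vertex (flowGraph S) (Ty.enc D) T} (hp : S.IsInjChain p)
    {v w v' w' : S.Dom T} (h : SameHistory d₀ d₁ p v w) (h' : SameHistory d₀ d₁ p v' w') :
    v = v' ↔ w = w' := by
  induction p with
  | nil =>
    obtain ⟨i, rfl, rfl⟩ := h
    obtain ⟨j, rfl, rfl⟩ := h'
    exact hd i j
  | cons p e ih =>
    obtain ⟨hp, hinj, -, hj⟩ := hp
    obtain ⟨r, hr, i, j, src, tgt⟩ := e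
    subst src
    subst tgt
    obtain ⟨x, y, u, z, hxy, h1, hu, hz, rfl, rfl⟩ := h
    obtain ⟨x', y', u', z', hxy', h1', hu', hz', rfl, rfl⟩ := h'
    have key : x i = x' i ↔ y i = y' i := ih hp h1 h1'
    change u j = u' j ↔ z j = z' j
    constructor
    · intro h
      obtain rfl : x = x' := hinj.eq_of_fun? hj hu hu' h
      have hy : y = y' := by
        funext i'
        by_cases hi : i' = i
        · exact (congrArg (fun i => y i = y' i) hi).mpr (key.1 rfl)
        · exact (hxy i' hi).symm.trans (hxy' i' hi)
      subst hy
      rw [Option.some.inj (hz.symm.trans hz')]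
    · intro h
      obtain rfl : y = y' := hinj.eq_of_fun? hj hz hz' h
      have hx : x = x' := by
        funext i'
        by_cases hi : i' = i
        · exact (congrArg (fun i => x i = x' i) hi).mpr (key.2 rfl)
        · exact (hxy i' hi).trans (hxy' i' hi).symm
      subst hx
      rw [Option.some.inj (hu.symm.trans hu')]

variable (d₀ d₁)

/-- Corresponding values: equal if they are visible or independent of the stored values, and with
the same history if they can leak. -/
def ValRel (T : Ty S.P S.E) (v w : S.Dom T) : Prop :=
  ((IsEmpty (S.Walk (.enc D) T) ∨ ∀ e, T ≠ .enc e) → v = w) ∧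
    (S.Leaks T → ∀ p : S.Walk (.enc D) T, SameHistory d₀ d₁ p v w)

/-- Hash tables that agree on corresponding values. -/
def HashRel (h h' : S.HashTable) : Prop :=
  ∀ T, Rule.hash T ∈ S.rules → ∀ v w, ValRel d₀ d₁ T v w → h T v = h' T w

variable {d₀ d₁}

theorem valRel_plain (hD : S.IsDeterministic D) {T : Ty S.P S.E} (hT : ∀ e, T ≠ .enc e)
    (v w : S.Dom T) : ValRel d₀ d₁ T v w ↔ v = w := by
  refine ⟨fun h => h.1 (Or.inr hT), fun h => ⟨fun _ => h, fun hl p => ?_⟩⟩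
  obtain ⟨e, he⟩ := hD.exists_eq_enc p hl
  exact (hT e he).elim

theorem ValRel.eq_iff (hD : S.IsDeterministic D) (hd : ∀ i j, d₀ i = d₀ j ↔ d₁ i = d₁ j)
    {T : Ty S.P S.E} (hT : S.Leaks T) {v w v' w' : S.Dom T} (h : ValRel d₀ d₁ T v w)
    (h' : ValRel d₀ d₁ T v' w') : v = v' ↔ w = w' := by
  by_cases hp : IsEmpty (S.Walk (.enc D) T)
  · rw [h.1 (Or.inl hp), h'.1 (Or.inl hp)]
  · obtain ⟨p⟩ := not_isEmpty_iff.1 hp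
    exact SameHistory.eq_iff hd (hD.isInjChain p hT) (h.2 hT p) (h'.2 hT p)

theorem leaks_of_equal {T : Ty S.P S.E} (h : Rule.equal T ∈ S.rules) : S.Leaks T :=
  Edge.leaks_of_tgt ⟨Rule.equal T, h, (0 : Fin 2), (0 : Fin 1), rfl, rfl⟩ (Or.inl rfl)

theorem leaks_of_hash {T : Ty S.P S.E} (h : Rule.hash T ∈ S.rules) : S.Leaks T :=
  Edge.leaks_of_tgt ⟨Rule.hash T, h, (0 : Fin 1), (0 : Fin 1), rfl, rfl⟩ (Or.inr rfl)

/-- If the output is unreachable or visible, no input can be reachable, so all inputs coincide. If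
it is reachable and can leak, strictness provides a reachable input, uniqueness makes it the only
one, and the history grows by one edge. -/
theorem valRel_fn (hD : S.IsDeterministic D) (hS : S.IsStrict D) {n m : ℕ}
    {inp : Fin n → Ty S.P S.E} {out : Fin m → Ty S.P S.E}
    {f : (∀ i, S.Dom (inp i)) → ∀ j, S.Dom (out j)}
    (hr : Rule.fn n m inp out f ∈ S.rules) {x x' : ∀ i, S.Dom (inp i)}
    (hx : ∀ i, ValRel d₀ d₁ (inp i) (x i) (x' i)) (j : Fin m) :
    ValRel d₀ d₁ (out j) (f x j) (f x' j) := by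
  refine ⟨fun h => ?_, fun hl p => ?_⟩
  · have : x = x' := by
      funext i
      refine (hx i).1 (Or.inl ⟨fun q => ?_⟩)
      rcases h with h | h
      · exact h.false (q.snoc (ruleEdge hr i j))
      · obtain ⟨e, he⟩ := hD.out_ne hr q j
        exact h e he
    rw [this]
  · obtain ⟨e, he⟩ := hD.exists_eq_enc p hl
    have hleak : S.OnLeakPath D e := by
      have key : ∀ T : Ty S.P S.E, T = .enc e → S.Leaks T → S.Walk (.enc D) T →
          S.OnLeakPath D e := by
        rintro T rfl h1 h2
        exact IsDeterministic.onLeakPath h2 h1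
      exact key _ he hl p
    obtain ⟨i, ⟨q⟩⟩ := hS e hleak _ hr j he
    -- Whatever walk `p` is given, it must end with the edge of the rule at hand.
    rw [hD.walk_eq q (ruleEdge hr i j) hl p]
    refine ⟨x, x', f x, f x', fun i' hi' => ?_, ?_, rfl, rfl, rfl, rfl⟩
    · exact (hx i').1 (Or.inl ⟨fun q' => hi' (hD.input_eq hr hl q q')⟩)
    · exact (hx i).2 ((ruleEdge hr i j).leaks hl) q

/-- Types with an `equal` or `hash` rule leak, so equality of values is the same on both sides. This
gives equal answers for `equal`; for `hash`, a fresh value is sampled jointly and is stored at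
corresponding places. -/
theorem eval_coupled (hD : S.IsDeterministic D) (hS : S.IsStrict D)
    (hd : ∀ i j, d₀ i = d₀ j ↔ d₁ i = d₁ j) (r : Rule S.toTypeSystem) (hr : r ∈ S.rules)
    (h h' : S.HashTable) (x x' : ∀ i, S.Dom (r.inp i)) (hh : HashRel d₀ d₁ h h')
    (hx : ∀ i, ValRel d₀ d₁ (r.inp i) (x i) (x' i)) :
    Coupled (fun y y' => (∀ j, ValRel d₀ d₁ (r.out j) (y.1 j) (y'.1 j)) ∧ HashRel d₀ d₁ y.2 y'.2)
      (S.eval h r x) (S.eval h' r x') := by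
  cases r with
  | fn n m inp out f => exact Coupled.pure ⟨fun j => valRel_fn hD hS hr hx j, hh⟩
  | equal T =>
    refine Coupled.pure ⟨fun j => (valRel_plain hD (by simp [Rule.out]) _ _).2 ?_, hh⟩
    have := ValRel.eq_iff hD hd (leaks_of_equal hr) (hx (0 : Fin 2)) (hx (1 : Fin 2))
    exact congrArg some (decide_eq_decide.2 this)
  | hash T =>
    have h0 : ValRel d₀ d₁ T (x (0 : Fin 1)) (x' (0 : Fin 1)) := hx (0 : Fin 1)
    have hval : ∀ v : S.HashVal, ∀ j : Fin 1, ValRel d₀ d₁ (Ty.hashDom) v v := fun v j =>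
      (valRel_plain hD (by simp) _ _).2 rfl
    have e0 := hh T hr _ _ h0
    unfold eval
    dsimp only
    cases hv : h T (x (0 : Fin 1)) with
    | some v =>
      have hv' : h' T (x' (0 : Fin 1)) = some v := e0 ▸ hv
      simp only [hv']
      exact Coupled.pure ⟨hval v, hh⟩
    | none =>
      have hv' : h' T (x' (0 : Fin 1)) = none := e0 ▸ hv
      simp only [hv']
      refine Coupled.map_same _ _ _ fun v _ => ⟨hval v, fun T' hT' a b hab => ?_⟩
      by_cases hTT : T' = T
      · subst hTT
        -- A related pair hits the new entry on both sides or on neither.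
        have hiff := ValRel.eq_iff hD hd (leaks_of_hash hr) hab h0
        by_cases ha : a = x (0 : Fin 1)
        · have hb := hiff.1 ha
          subst ha
          subst hb
          simp only [Function.update_self]
          have key : ∀ (g : S.Dom T' → Option S.HashVal) b,
              Function.update g b (some v) b = some v :=
            fun g b => Function.update_self _ _ _
          exact (key (h T') _).trans (key (h' T') _).symm
        · have hb := fun hb => ha (hiff.2 hb)
          simpa [Function.update_of_ne ha, Function.update_of_ne hb] using hh T' hT' a b hab
      · simpa [hTT] using hh T' hT' a b hab

/-- Replaces values that depend on the stored values by a default. -/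
def mask (S : Schema) (D e : S.E) (v : S.domE e) : S.domE e :=
  if Nonempty (S.Walk (.enc D) (.enc e)) then Classical.arbitrary _ else v

theorem ValRel.mask_eq {e : S.E} {v w : S.domE e} (h : ValRel d₀ d₁ (.enc e) v w) :
    S.mask D e v = S.mask D e w := by
  unfold mask
  split_ifs with hp
  · rfl
  · exact h.1 (Or.inl (not_nonempty_iff.1 hp))

/-- Only the equality among the stored values is leaked. -/
theorem indist_of_eq_iff (hD : S.IsDeterministic D) (hS : S.IsStrict D) {a : ℕ} (ha : 1 ≤ a)
    (hSa : S.ArityLE a) (hd : ∀ i j, d₀ i = d₀ j ↔ d₁ i = d₁ j) :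
    S.Indist a (S.world D d₀) (S.world D d₁) := by
  refine indist_of_cpaMachine_eq ha hSa (S.mask D) d₀ d₁ fun A => ?_
  refine machine_prob_eq (VR := ValRel d₀ d₁) (HR := HashRel d₀ d₁) (RO := Eq)
    (fun T hT v w => valRel_plain hD hT v w) (fun _ _ _ _ _ => rfl) (eval_coupled hD hS hd)
    (Coupled.refl _ fun _ _ => rfl) ?_ ?_ ?_ ?_ A
  · suffices hv : ∀ e (v w : S.domE e) (o : S.Keys), ValRel d₀ d₁ (.enc e) v w →
        Coupled (fun x y => x.1 = y.1 ∧ x.2 = y.2)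
          (((S.cpaService (S.mask D)).enc e v).runFrom (S.cpaPi fun _ => true) o)
          (((S.cpaService (S.mask D)).enc e w).runFrom (S.cpaPi fun _ => true) o) by
      rintro e v w o _ h rfl
      exact hv e v w o h
    intro e v w o h
    rw [cpaService_runFrom_enc, cpaService_runFrom_enc, h.mask_eq]
    exact Coupled.refl _ fun _ _ => ⟨rfl, rfl⟩
  · rintro e c o _ rfl
    exact Coupled.refl _ fun _ _ => rfl
  · intro i
    refine ⟨fun h => ?_, fun hl p => ?_⟩
    · rcases h with h | h
      · exact (h.false Quiver.Path.nil).elim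
      · exact (h D rfl).elim
    -- A stored value has the trivial history only, since no proper cycle through `D` survives
    -- uniqueness when `D` leaks.
    · rw [hD.walk_self_eq_nil hl p]
      exact ⟨i, rfl, rfl⟩
  · intro e he v
    exact ⟨fun _ => rfl, fun hl p => (he (IsDeterministic.onLeakPath p hl)).elim⟩

/-- The leakage of deterministic encryption suffices to simulate the database. -/
theorem exists_simulator (hD : S.IsDeterministic D) (hS : S.IsStrict D) {a : ℕ} (ha : 1 ≤ a)
    (hSa : S.ArityLE a) (ι : Type) (Δ : DetEnc (S.domE D)) :
    ∃ Sim : (ι → Δ.Cipher) → System (S.advI D ι), ∀ (k : Δ.Key) (d : ι → S.domE D),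
      S.Indist a (S.world D d) (Sim fun i => Δ.enc k (d i)) := by
  -- The simulator chooses some stored values and some key that explain the ciphertexts. The key
  -- need not be the true one, since equality of ciphertexts shows the equality pattern under any
  -- key.
  refine ⟨fun c => if h : ∃ (d : ι → S.domE D) (k : Δ.Key), c = fun i => Δ.enc k (d i) then
    S.world D h.choose else S.world D fun _ => Classical.arbitrary _, fun k d => ?_⟩
  have h : ∃ (d' : ι → S.domE D) (k' : Δ.Key),
    (fun i => Δ.enc k (d i)) = fun i => Δ.enc k' (d' i) := ⟨d, k, rfl⟩
  refine (congrArg (S.Indist a _) (dif_pos h)).mpr ?_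
  refine indist_of_eq_iff hD hS ha hSa fun i j => ?_
  obtain ⟨k', hk'⟩ := h.choose_spec
  rw [← Δ.enc_eq_iff k, congrFun hk' i, congrFun hk' j, Δ.enc_eq_iff]

end ValRel

end Schema

/-! ### Supports of program runs and calls on valid inputs -/

theorem pmf_bind_apply_of_const {α β : Type*} {p : PMF α} {f : α → PMF β} {b : β} {c : ENNReal}
    (h : ∀ a ∈ p.support, f a b = c) : p.bind f b = c := by
  rw [PMF.bind_apply]
  have : ∀ a, p a * f a b = p a * c := fun a => by
    by_cases ha : p a = 0
    · simp [ha]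
    · rw [h a ((PMF.mem_support_iff _ _).2 ha)]
  rw [tsum_congr this, ENNReal.tsum_mul_right, PMF.tsum_coe, one_mul]

theorem Prog.traverse_support {I : Interface} {O : System I} {σ : Type} {n : ℕ} {α : Fin n → Type}
    {g : ∀ i, σ → Prog I (α i × σ)} {P : ∀ i, α i → Prop} {o : O.State}
    (h : ∀ i s, ∀ x ∈ ((g i s).runFrom O o).support, x.2 = o ∧ P i x.1.1) (s : σ) :
    ∀ x ∈ ((traverse g s).runFrom O o).support, x.2 = o ∧ ∀ i, P i (x.1.1 i) := by
  induction n generalizing s with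
  | zero =>
    intro x hx
    rw [traverse, runFrom, PMF.support_pure, Set.mem_singleton_iff] at hx
    subst hx
    exact ⟨rfl, fun i => i.elim0⟩
  | succ n ih =>
    intro x hx
    rw [traverse, runFrom_bind, PMF.mem_support_bind_iff] at hx
    obtain ⟨y, hy, hx⟩ := hx
    obtain ⟨hy1, hy2⟩ := h 0 s y hy
    rw [runFrom_bind, PMF.mem_support_bind_iff, hy1] at hx
    obtain ⟨z, hz, hx⟩ := hx
    obtain ⟨hz1, hz2⟩ := ih (P := fun i => P i.succ) (fun i => h i.succ) y.1.2 z hz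
    rw [runFrom, PMF.support_pure, Set.mem_singleton_iff] at hx
    subst hx
    refine ⟨hz1, fun i => ?_⟩
    refine Fin.cases ?_ (fun i => ?_) i
    · exact hy2
    · exact hz2 i

theorem Prog.mem_support_runFrom_bind {I : Interface} {O : System I} {α β : Type} {A : Prog I α}
    {f : α → Prog I β} {s : O.State} {x : β × O.State}
    (hx : x ∈ ((A.bind f).runFrom O s).support) :
    ∃ a s', (a, s') ∈ (A.runFrom O s).support ∧ x ∈ ((f a).runFrom O s').support := by
  rw [runFrom_bind, PMF.mem_support_bind_iff] at hx
  obtain ⟨⟨a, s'⟩, ha, hx⟩ := hx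
  exact ⟨a, s', ha, hx⟩

theorem Prog.map_fst_runFrom_bind {I : Interface} {O : System I} {α β : Type} (A : Prog I α)
    (f : α → Prog I β) (s : O.State) : ((A.bind f).runFrom O s).map Prod.fst =
      (A.runFrom O s).bind fun x => ((f x.1).runFrom O x.2).map Prod.fst := by
  rw [runFrom_bind, PMF.map_bind]

namespace Schema

theorem mem_support_pmfPi {n : ℕ} {α : Fin n → Type} {p : ∀ i, PMF (α i)} {x : ∀ i, α i}
    (hx : x ∈ (pmfPi p).support) (i : Fin n) : x i ∈ (p i).support := by
  induction n with
  | zero => exact i.elim0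
  | succ n ih =>
    simp only [pmfPi, PMF.mem_support_bind_iff, PMF.mem_support_map_iff] at hx
    obtain ⟨a, ha, f, hf, rfl⟩ := hx
    refine Fin.cases ?_ (fun i => ?_) i
    · exact ha
    · exact ih hf i

theorem pmfPi_pure {n : ℕ} {α : Fin n → Type} (x : ∀ i, α i) :
    pmfPi (fun i => PMF.pure (x i)) = PMF.pure x := by
  induction n with
  | zero => exact congrArg PMF.pure (funext fun i => i.elim0)
  | succ n ih =>
    rw [pmfPi, PMF.pure_bind, ih, PMF.pure_map]
    exact congrArg PMF.pure (Fin.cons_self_tail x)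

variable {S : Schema} {D : S.E} {ι : Type}

instance domNonempty (T : Ty S.P S.E) : Nonempty (S.Dom T) := by
  cases T with
  | boolean => exact ⟨(none : Option Bool)⟩
  | hashDom => exact S.hashNonempty
  | plain t => exact S.domP_nonempty t
  | enc e => exact S.domE_nonempty e

instance wireNonempty (T : Ty S.P S.E) : Nonempty (S.Wire T) := by
  cases T with
  | boolean => exact ⟨(none : Option Bool)⟩
  | hashDom => exact S.hashNonempty
  | plain t => exact S.domP_nonempty t
  | enc e =>
    obtain ⟨c, -⟩ :=
      ((S.scheme e).enc (Classical.arbitrary _) (Classical.arbitrary _)).support_nonempty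
    exact ⟨c⟩

theorem decode_of_mem_encode {k : S.Keys} {T : Ty S.P S.E} {v : S.Dom T} {w : S.Wire T}
    (h : w ∈ (S.encode k T v).support) : S.decode k T w = some v := by
  cases T with
  | enc e => exact (S.scheme e).correct _ _ _ h
  | _ => exact congrArg some ((PMF.mem_support_pure_iff _ _).1 h)

theorem tmCall_eq {k : S.Keys} {h : S.HashTable} {r : Rule S.toTypeSystem}
    {args : ∀ i, S.Wire (r.inp i)} {x : ∀ i, S.Dom (r.inp i)}
    (hx : ∀ i, S.decode k (r.inp i) (args i) = some (x i)) :
    S.tmCall k h r args = (S.eval h r x).bind fun y =>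
      (pmfPi fun j => S.encode k (r.out j) (y.1 j)).map fun w => (some w, y.2) := by
  unfold tmCall
  simp only [hx, Option.isSome_some, implies_true, dite_true, Option.get_some]

theorem runFrom_read {α : Type} (d : ι → S.domE D) (i : ι)
    (K : (S.scheme D).Cipher → Prog (S.advI D ι) α) (s : S.Keys × S.HashTable) :
    (Prog.ask (I := S.advI D ι) (.read i) K).runFrom (S.world D d) s =
      ((S.scheme D).enc (s.1 D) (d i)).bind fun c => (K c).runFrom (S.world D d) s :=
  PMF.bind_map _ _ _

theorem runFrom_encrypt {α : Type} (d : ι → S.domE D) (e : S.E) (he : ¬ S.OnLeakPath D e)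
    (v : S.domE e) (K : (S.scheme e).Cipher → Prog (S.advI D ι) α) (s : S.Keys × S.HashTable) :
    (Prog.ask (I := S.advI D ι) (.encrypt e he v) K).runFrom (S.world D d) s =
      ((S.scheme e).enc (s.1 e) v).bind fun c => (K c).runFrom (S.world D d) s :=
  PMF.bind_map _ _ _

theorem runFrom_call {α : Type} (d : ι → S.domE D) (r : Rule S.toTypeSystem) (hr : r ∈ S.rules)
    (args : ∀ i, S.Wire (r.inp i))
    (K : Option (∀ j, S.Wire (r.out j)) → Prog (S.advI D ι) α) (s : S.Keys × S.HashTable) :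
    (Prog.ask (I := S.advI D ι) (.call r hr args) K).runFrom (S.world D d) s =
      (S.tmCall s.1 s.2 r args).bind fun x => (K x.1).runFrom (S.world D d) (s.1, x.2) :=
  PMF.bind_map _ _ _

/-! ## Adversaries that test for equality -/

/-- Obtains a valid representation of a default value of a type that is not on a leak path. -/
def supply (S : Schema) (D : S.E) (ι : Type) : (T : Ty S.P S.E) → Prog (S.advI D ι) (S.Wire T)
  | .boolean => .ret (Classical.arbitrary (S.Dom .boolean))
  | .hashDom => .ret (Classical.arbitrary (S.Dom .hashDom))
  | .plain t => .ret (Classical.arbitrary (S.Dom (.plain t)))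
  | .enc e =>
    if he : ¬ S.OnLeakPath D e then
      .ask (I := S.advI D ι) (.encrypt e he (Classical.arbitrary (S.Dom (.enc e))))
        fun c : (S.scheme e).Cipher => .ret c
    else .ret (Classical.arbitrary _)

theorem supply_atMost (T : Ty S.P S.E) : (S.supply D ι T).AtMost 1 := by
  cases T with
  | enc e =>
    change Prog.AtMost (dite _ _ _) 1
    split_ifs
    · trivial
    · exact fun _ => trivial
  | _ => trivial

theorem supply_support (d : ι → S.domE D) (s : S.Keys × S.HashTable) {T : Ty S.P S.E}
    (hT : IsEmpty (S.Walk (.enc D) T)) :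
    ∀ x ∈ ((S.supply D ι T).runFrom (S.world D d) s).support,
      x.2 = s ∧ S.decode s.1 T x.1 = some (Classical.arbitrary (S.Dom T)) := by
  cases T with
  | enc e =>
    have he : ¬ S.OnLeakPath D e := fun h => h.1.elim hT.false
    intro x hx
    have hs : S.supply D ι (.enc e) =
        .ask (I := S.advI D ι) (.encrypt e he (Classical.arbitrary (S.Dom (.enc e))))
          fun c : (S.scheme e).Cipher => .ret c := dif_pos he
    have hrun := (congrArg (fun A => Prog.runFrom (S.world D d) A s) hs).trans
      (runFrom_encrypt d e he _ _ s)
    obtain ⟨c, hc, hx⟩ := (PMF.mem_support_bind_iff _ _ _).1 (hrun ▸ hx)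
    obtain rfl := (PMF.mem_support_pure_iff _ _).1 hx
    exact ⟨rfl, decode_of_mem_encode (T := .enc e) hc⟩
  | _ =>
    intro x hx
    obtain rfl := (PMF.mem_support_pure_iff _ _).1 hx
    exact ⟨rfl, rfl⟩

/-- A value of type `D` can be carried along a path injectively. -/
theorem exists_lift (hD : S.IsDeterministic D) (ι : Type) {T : S.Vertex}
    (p : @Quiver.Path S.Vertex (flowGraph S) (Ty.enc D) T) (hT : S.Leaks T) :
    ∃ (g : S.domE D → S.Dom T) (n : ℕ) (A : (S.scheme D).Cipher → Prog (S.advI D ι) (S.Wire T)),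
      Function.Injective g ∧ (∀ c, (A c).AtMost n) ∧
      ∀ (d : ι → S.domE D) (s : S.Keys × S.HashTable) c v, (S.scheme D).dec (s.1 D) c = some v →
        ∀ x ∈ ((A c).runFrom (S.world D d) s).support,
          x.2 = s ∧ S.decode s.1 T x.1 = some (g v) := by
  induction p with
  | nil =>
    refine ⟨id, 0, fun c => .ret c, fun _ _ h => h, fun _ => trivial, fun d s c v hc x hx => ?_⟩
    obtain rfl := (PMF.mem_support_pure_iff _ _).1 hx
    exact ⟨rfl, hc⟩
  | cons p e ih =>
    have hchain := hD.isInjChain (Walk.snoc p e) hT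
    obtain ⟨-, hinj, -, hj⟩ := hchain
    obtain ⟨r, hr, i, j, src, tgt⟩ := e
    subst src
    subst tgt
    obtain ⟨g, n, A, hg, hA, hsupp⟩ := ih ((ruleEdge hr i j).leaks hT)
    cases r with
    | equal T => exact hinj.elim
    | hash T => exact hinj.elim
    -- The carried value enters at position `i`, and all other inputs are fixed defaults. The cost
    -- is that of the prefix, at most one encryption per input, and one call.
    | fn n' m inp out f =>
      let side : (∀ i, S.Dom (inp i)) := fun i => Classical.arbitrary _
      let prep : S.Wire (inp i) → ∀ i', Unit → Prog (S.advI D ι) (S.Wire (inp i') × Unit) :=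
        fun w i' _ => if h : i = i' then .ret (h ▸ w, ()) else
          (S.supply D ι (inp i')).bind fun x => .ret (x, ())
      refine ⟨fun v => f (Function.update side i (g v)) j, n + (n' * 1 + 1), fun c =>
        (A c).bind fun w => (Prog.traverse (prep w) ()).bind fun args =>
          .ask (I := S.advI D ι) (.call (.fn n' m inp out f) hr args.1)
            fun o : Option (∀ j, S.Wire (out j)) =>
              .ret (o.elim (Classical.arbitrary _) fun u => u j), ?_, ?_, ?_⟩
      · intro v v' hv
        obtain ⟨h0, hinj⟩ := hinj
        obtain rfl : j = ⟨0, h0⟩ := Fin.ext hj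
        have := congrFun (hinj hv) i
        exact hg (((Function.update_self (β := fun i => S.Dom (inp i)) i (g v) side).symm.trans
          this).trans (Function.update_self (β := fun i => S.Dom (inp i)) i (g v') side))
      · intro c
        refine (hA c).bind fun w => (Prog.AtMost.traverse (fun i' u => ?_) _).bind
          fun args => fun _ => trivial
        by_cases h : i = i'
        · simp only [prep, dif_pos h]; trivial
        · simp only [prep, dif_neg h]
          exact (supply_atMost _).bind (n := 0) fun _ => trivial
      · intro d s c v hc x hx
        obtain ⟨w, s', hw, hx₁⟩ := Prog.mem_support_runFrom_bind hx
        obtain ⟨hw1, hw2⟩ := hsupp d s c v hc _ hw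
        obtain rfl : s' = s := hw1
        obtain ⟨args, s₁, hargs, hx₂⟩ := Prog.mem_support_runFrom_bind hx₁
        have hprep : ∀ i' u, ∀ x ∈ ((prep w i' u).runFrom (S.world D d) s').support,
            x.2 = s' ∧ S.decode s'.1 (inp i') x.1.1 = some (Function.update side i (g v) i') := by
          intro i' u x hx
          by_cases h : i = i'
          · subst h
            simp only [prep, dite_true] at hx
            obtain rfl := (PMF.mem_support_pure_iff _ _).1 hx
            exact ⟨rfl, hw2.trans (congrArg some
              (Function.update_self (β := fun i => S.Dom (inp i)) i (g v) side).symm)⟩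
          · simp only [prep, dif_neg h] at hx
            obtain ⟨y, s₂, hy, hx⟩ := Prog.mem_support_runFrom_bind hx
            -- Side inputs are unreachable from `D`, hence not on a leak path, so the adversary may
            -- encrypt the defaults itself.
            have hempty : IsEmpty (S.Walk (.enc D) (inp i')) :=
              ⟨fun q => h (hD.input_eq hr hT p q).symm⟩
            obtain ⟨hy1, hy2⟩ := supply_support d s' hempty _ hy
            obtain rfl := (PMF.mem_support_pure_iff _ _).1 hx
            exact ⟨hy1, hy2.trans (congrArg some
              (Function.update_of_ne (β := fun i => S.Dom (inp i)) (Ne.symm h) (g v) side).symm)⟩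
        obtain ⟨ha1, ha2⟩ := Prog.traverse_support
          (P := fun i' w => S.decode s'.1 (inp i') w = some (Function.update side i (g v) i'))
          hprep () _ hargs
        obtain rfl : s₁ = s' := ha1
        have hrun := (runFrom_call d (.fn n' m inp out f) hr args.1 (fun o =>
          .ret (o.elim (Classical.arbitrary _) fun u => u j)) s₁).trans
            (congrArg (fun p => PMF.bind p _) (tmCall_eq (r := .fn n' m inp out f) ha2))
        obtain ⟨y, hy, hx⟩ := (PMF.mem_support_bind_iff _ _ _).1 (hrun ▸ hx₂)
        obtain ⟨z, hz, hy⟩ := (PMF.mem_support_bind_iff _ _ _).1 hy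
        obtain rfl := (PMF.mem_support_pure_iff _ _).1 hz
        obtain ⟨u, hu, rfl⟩ := (PMF.mem_support_map_iff _ _ _).1 hy
        obtain rfl := (PMF.mem_support_pure_iff _ _).1 hx
        -- Function rules leave the hash table alone, so the state is unchanged; the hash test
        -- relies on the table still being empty.
        exact ⟨rfl, decode_of_mem_encode (mem_support_pmfPi hu j)⟩

/-- Two stored values can be carried along a path injectively. -/
theorem exists_lift_pair (hD : S.IsDeterministic D) {T : S.Vertex}
    (p : @Quiver.Path S.Vertex (flowGraph S) (Ty.enc D) T) (hT : S.Leaks T) (i j : ι) :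
    ∃ (g : S.domE D → S.Dom T) (n : ℕ) (A : Prog (S.advI D ι) (S.Wire T × S.Wire T)),
      Function.Injective g ∧ A.AtMost n ∧
      ∀ (d : ι → S.domE D) (s : S.Keys × S.HashTable),
        ∀ x ∈ (A.runFrom (S.world D d) s).support, x.2 = s ∧
          S.decode s.1 T x.1.1 = some (g (d i)) ∧ S.decode s.1 T x.1.2 = some (g (d j)) := by
  obtain ⟨g, n, A, hg, hA, hsupp⟩ := exists_lift hD ι p hT
  have hread : ∀ (i : ι) (d : ι → S.domE D) (s : S.Keys × S.HashTable),
      ∀ x ∈ ((Prog.ask (I := S.advI D ι) (.read i) A).runFrom (S.world D d) s).support,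
        x.2 = s ∧ S.decode s.1 T x.1 = some (g (d i)) := by
    intro i d s x hx
    rw [runFrom_read] at hx
    obtain ⟨c, hc, hx⟩ := (PMF.mem_support_bind_iff _ _ _).1 hx
    exact hsupp d s c (d i) ((S.scheme D).correct _ _ _ hc) x hx
  refine ⟨g, (n + 1) + ((n + 1) + 0), (Prog.ask (I := S.advI D ι) (.read i) A).bind fun w =>
    (Prog.ask (I := S.advI D ι) (.read j) A).bind fun w' => .ret (w, w'), hg, ?_, ?_⟩
  · exact Prog.AtMost.bind (fun c => hA c) fun w =>
      Prog.AtMost.bind (fun c => hA c) fun _ => trivial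
  · intro d s x hx
    obtain ⟨w, s', hw, hx₁⟩ := Prog.mem_support_runFrom_bind hx
    obtain ⟨hw1, hw2⟩ := hread i d s _ hw
    obtain rfl : s' = s := hw1
    obtain ⟨w', s₁, hw', hx₂⟩ := Prog.mem_support_runFrom_bind hx₁
    obtain ⟨hstate, hright⟩ := hread j d s' _ hw'
    obtain rfl := (PMF.mem_support_pure_iff _ _).1 hx₂
    exact ⟨hstate, hw2, hright⟩

/-- The probability of an output, if the rest of the program yields it with the same probability
after every run of the first part. -/
theorem prob_bind_eq {α : Type} {d : ι → S.domE D} {A : Prog (S.advI D ι) α}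
    {K : α → Prog (S.advI D ι) Bool} {b : Bool} {ρ : ENNReal}
    (h : ∀ k : S.Keys, ∀ x ∈ (A.runFrom (S.world D d) (k, fun _ _ => none)).support,
      ((K x.1).runFrom (S.world D d) x.2).map Prod.fst b = ρ) :
    (A.bind K).prob (S.world D d) b = ρ.toReal := by
  unfold Prog.prob Prog.run
  rw [PMF.map_bind]
  refine congrArg _ (pmf_bind_apply_of_const fun s hs => ?_)
  obtain ⟨k, -, rfl⟩ := (PMF.mem_support_map_iff _ _ _).1 hs
  exact (DFunLike.congr_fun (Prog.map_fst_runFrom_bind _ _ _) b).trans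
    (pmf_bind_apply_of_const fun x hx => h k x hx)

/-- Asks the trusted machine whether two values are equal. -/
def askEqual {T : Ty S.P S.E} (hr : Rule.equal T ∈ S.rules) (D : S.E) (ι : Type)
    (w : S.Wire T × S.Wire T) : Prog (S.advI D ι) Bool :=
  .ask (I := S.advI D ι) (.call (.equal T) hr fun i : Fin 2 => if i = 0 then w.1 else w.2)
    fun o : Option (Fin 1 → Option Bool) => .ret (decide (o = some fun _ => some true))

/-- Asks the trusted machine for the hash of a value. -/
def askHash {T : Ty S.P S.E} (hr : Rule.hash T ∈ S.rules) (D : S.E) (ι : Type) (w : S.Wire T) :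
    Prog (S.advI D ι) S.HashVal :=
  .ask (I := S.advI D ι) (.call (.hash T) hr fun _ => w)
    fun o : Option (Fin 1 → S.HashVal) => .ret (o.elim (Classical.arbitrary _) fun u => u 0)

theorem tmCall_equal {k : S.Keys} {h : S.HashTable} {T : Ty S.P S.E} {w w' : S.Wire T}
    {v v' : S.Dom T} (hv : S.decode k T w = some v) (hv' : S.decode k T w' = some v') :
    S.tmCall k h (.equal T) (fun i : Fin 2 => if i = 0 then w else w') =
      PMF.pure (some fun _ => some (decide (v = v')), h) := by
  refine (tmCall_eq (r := .equal T) (x := fun i : Fin 2 => if i = 0 then v else v') ?_).trans ?_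
  · intro i
    by_cases hi : i = (0 : Fin 2)
    · subst hi; exact hv
    · refine (congrArg (S.decode k T) (if_neg hi)).trans (hv'.trans ?_)
      exact congrArg some (if_neg hi).symm
  · refine (PMF.pure_bind _ _).trans ?_
    refine (congrArg (PMF.map _) (pmfPi_pure _)).trans ((PMF.pure_map _ _).trans ?_)
    rfl

theorem tmCall_hash {k : S.Keys} {h : S.HashTable} {T : Ty S.P S.E} {w : S.Wire T} {v : S.Dom T}
    (hv : S.decode k T w = some v) :
    S.tmCall k h (.hash T) (fun _ => w) =
      match h T v with
      | some u => PMF.pure (some fun _ => u, h)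
      | none => (PMF.uniformOfFintype S.HashVal).map fun u =>
          (some fun _ => u, Function.update h T (Function.update (h T) v (some u))) := by
  rw [tmCall_eq (r := .hash T) (x := fun _ => v) fun _ => hv]
  have hp : ∀ u : S.HashVal, ∀ h' : S.HashTable,
      (pmfPi fun j => S.encode k ((Rule.hash T).out j) u).map
        (fun w => ((some w : Option (∀ j, S.Wire ((Rule.hash T).out j))), h')) =
      PMF.pure (some fun _ => u, h') := fun u h' =>
    (congrArg (PMF.map _) (pmfPi_pure fun _ => u)).trans (PMF.pure_map _ _)
  unfold eval
  dsimp only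
  cases h T v with
  | some u => exact (PMF.pure_bind _ _).trans (hp u h)
  | none => exact (PMF.bind_map _ _ _).trans (congrArg (PMF.bind _) (funext fun u => hp u _))

theorem runFrom_askEqual {T : Ty S.P S.E} (hr : Rule.equal T ∈ S.rules) (d : ι → S.domE D)
    {s : S.Keys × S.HashTable} {w : S.Wire T × S.Wire T} {v v' : S.Dom T}
    (hv : S.decode s.1 T w.1 = some v) (hv' : S.decode s.1 T w.2 = some v') :
    (askEqual hr D ι w).runFrom (S.world D d) s = PMF.pure (decide (v = v'), s) := by
  refine (runFrom_call d _ hr _ _ s).trans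
    ((congrArg (fun p => PMF.bind p _) (tmCall_equal hv hv')).trans ((PMF.pure_bind _ _).trans ?_))
  refine congrArg (fun b => PMF.pure (b, s)) (decide_eq_decide.2 ⟨fun h => ?_, fun h => ?_⟩)
  · exact of_decide_eq_true (Option.some.inj (congrFun (Option.some.inj h) (0 : Fin 1)))
  · exact congrArg (fun b => some fun _ : Fin 1 => some b) (decide_eq_true h)

theorem runFrom_askHash_of_some {T : Ty S.P S.E} (hr : Rule.hash T ∈ S.rules) (d : ι → S.domE D)
    {s : S.Keys × S.HashTable} {w : S.Wire T} {v : S.Dom T} (hv : S.decode s.1 T w = some v)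
    {u : S.HashVal} (hu : s.2 T v = some u) :
    (askHash hr D ι w).runFrom (S.world D d) s = PMF.pure (u, s) := by
  have h := tmCall_hash (h := s.2) hv
  rw [hu] at h
  exact (runFrom_call d _ hr _ _ s).trans
    ((congrArg (fun p => PMF.bind p _) h).trans (PMF.pure_bind _ _))

theorem runFrom_askHash_of_none {T : Ty S.P S.E} (hr : Rule.hash T ∈ S.rules) (d : ι → S.domE D)
    {s : S.Keys × S.HashTable} {w : S.Wire T} {v : S.Dom T} (hv : S.decode s.1 T w = some v)
    (hu : s.2 T v = none) :
    (askHash hr D ι w).runFrom (S.world D d) s = (PMF.uniformOfFintype S.HashVal).map fun u =>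
      (u, (s.1, Function.update s.2 T (Function.update (s.2 T) v (some u)))) := by
  have h := tmCall_hash (h := s.2) hv
  rw [hu] at h
  exact (runFrom_call d _ hr _ _ s).trans
    ((congrArg (fun p => PMF.bind p _) h).trans (PMF.bind_map _ _ _))

/-- Compares the hashes of two values. -/
def hashTest {T : Ty S.P S.E} (hr : Rule.hash T ∈ S.rules) (D : S.E) (ι : Type)
    (w : S.Wire T × S.Wire T) : Prog (S.advI D ι) Bool :=
  (askHash hr D ι w.1).bind fun u => (askHash hr D ι w.2).bind fun u' => .ret (decide (u = u'))

theorem uniform_map_decide_eq_false {X : Type} [Fintype X] [Nonempty X] (u : X) :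
    ((PMF.uniformOfFintype X).map fun u' => decide (u = u')) false =
      (Fintype.card X - 1 : ℕ) * (Fintype.card X : ENNReal)⁻¹ := by
  have hiff : ∀ u', (false = decide (u = u')) ↔ u' ≠ u := fun u' => by
    rw [eq_comm, decide_eq_false_iff_not, ne_comm]
  simp only [PMF.map_apply, hiff, tsum_fintype, PMF.uniformOfFintype_apply]
  rw [← Finset.sum_filter, Finset.sum_const, Finset.filter_ne', Finset.card_erase_of_mem
    (Finset.mem_univ _), Finset.card_univ, nsmul_eq_mul]

/-- Starting from an empty table, the first hash is uniform. The second repeats it if the values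
agree, and is an independent uniform sample otherwise. The probability may therefore be computed for
each first hash `u` separately. -/
theorem hashTest_apply {T : Ty S.P S.E} (hr : Rule.hash T ∈ S.rules) (d : ι → S.domE D)
    {k : S.Keys} {w : S.Wire T × S.Wire T} {v v' : S.Dom T} (hv : S.decode k T w.1 = some v)
    (hv' : S.decode k T w.2 = some v') {b : Bool} {ρ : ENNReal}
    (h : ∀ u : S.HashVal, (if v' = v then PMF.pure true else
      (PMF.uniformOfFintype S.HashVal).map fun u' => decide (u = u')) b = ρ) :
    ((hashTest hr D ι w).runFrom (S.world D d) (k, fun _ _ => none)).map Prod.fst b = ρ := by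
  refine (DFunLike.congr_fun (Prog.map_fst_runFrom_bind _ _ _) b).trans
    (pmf_bind_apply_of_const fun x hx => ?_)
  have hrun := runFrom_askHash_of_none (ι := ι) hr d (s := (k, fun _ _ => none)) hv rfl
  obtain ⟨u, -, rfl⟩ := (PMF.mem_support_map_iff _ _ _).1 (hrun ▸ hx)
  refine Eq.trans (DFunLike.congr_fun ?_ b) (h u)
  refine (Prog.map_fst_runFrom_bind _ _ _).trans ?_
  split_ifs with hvv
  · refine (congrArg (fun p => PMF.bind p _)
      (runFrom_askHash_of_some hr d hv' (u := u) ?_)).trans ?_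
    · simp [hvv]
    · refine (PMF.pure_bind _ _).trans ((PMF.pure_map _ _).trans ?_)
      simp
  · refine (congrArg (fun p => PMF.bind p _) (runFrom_askHash_of_none hr d hv' ?_)).trans ?_
    · simp [Function.update_of_ne hvv]
    · refine (PMF.bind_map _ _ _).trans (congrArg (PMF.bind _) (funext fun u' => ?_))
      exact PMF.pure_map _ _

theorem exists_equality_test (hD : S.IsDeterministic D)
    (hB : Nonempty (S.Walk (.enc D) .boolean)) (i j : ι) :
    ∃ (n : ℕ) (A : Prog (S.advI D ι) Bool), A.AtMost n ∧
      ∀ d : ι → S.domE D, (d i = d j → A.prob (S.world D d) true = 1) ∧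
        (d i ≠ d j → A.prob (S.world D d) false = 1) := by
  obtain ⟨p⟩ := hB
  obtain ⟨T, q, e, rfl, -, he⟩ := hD.to_boolean p
  have hr : Rule.equal T ∈ S.rules := he ▸ Edge.mem e
  obtain ⟨g, n, A, hg, hA, hsupp⟩ := exists_lift_pair hD q (leaks_of_equal hr) i j
  have hK : ∀ d : ι → S.domE D,
      (A.bind (askEqual hr D ι)).prob (S.world D d) (decide (d i = d j)) = 1 := by
    intro d
    rw [prob_bind_eq (ρ := 1), ENNReal.toReal_one]
    rintro k ⟨w, s⟩ hx
    obtain ⟨h1, h2, h3⟩ := hsupp d (k, fun _ _ => none) _ hx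
    obtain rfl : s = (k, fun _ _ => none) := h1
    refine (DFunLike.congr_fun (congrArg (PMF.map Prod.fst)
      (runFrom_askEqual hr d h2 h3)) _).trans ?_
    refine (DFunLike.congr_fun (PMF.pure_map _ _) _).trans
      ((PMF.pure_apply _ _).trans (if_pos ?_))
    -- The machine compares the images under `g`, which is injective.
    exact decide_eq_decide.2 hg.eq_iff.symm
  refine ⟨n + 1, A.bind (askEqual hr D ι), hA.bind fun w _ => trivial,
    fun d => ⟨fun h => ?_, fun h => ?_⟩⟩
  · simpa [h] using hK d
  · simpa [h] using hK d

theorem exists_hash_test (hD : S.IsDeterministic D)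
    (hB : Nonempty (S.Walk (.enc D) .hashDom)) (i j : ι) :
    ∃ (n : ℕ) (A : Prog (S.advI D ι) Bool), A.AtMost n ∧
      ∀ d : ι → S.domE D, (d i = d j → A.prob (S.world D d) true = 1) ∧
        (d i ≠ d j → A.prob (S.world D d) false = 1 - 1 / (Fintype.card S.HashVal : ℝ)) := by
  obtain ⟨p⟩ := hB
  obtain ⟨T, q, e, rfl, -, he⟩ := hD.to_hashDom p
  have hr : Rule.hash T ∈ S.rules := he ▸ Edge.mem e
  obtain ⟨g, n, A, hg, hA, hsupp⟩ := exists_lift_pair hD q (leaks_of_hash hr) i j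
  refine ⟨n + 2, A.bind (hashTest hr D ι), hA.bind fun w _ _ => trivial,
    fun d => ⟨fun h => ?_, fun h => ?_⟩⟩
  · rw [prob_bind_eq (ρ := 1), ENNReal.toReal_one]
    rintro k ⟨w, s⟩ hx
    obtain ⟨h1, h2, h3⟩ := hsupp d (k, fun _ _ => none) _ hx
    obtain rfl : s = (k, fun _ _ => none) := h1
    refine hashTest_apply hr d h2 h3 fun u => ?_
    rw [if_pos (congrArg g h.symm)]
    simp
  · have hcard : (0 : ℝ) < Fintype.card S.HashVal := by exact_mod_cast Fintype.card_pos
    -- All but one of the possible second hashes differ from the first. The truncated subtraction is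
    -- harmless because the hash domain is nonempty.
    rw [prob_bind_eq (ρ := (Fintype.card S.HashVal - 1 : ℕ) * (Fintype.card S.HashVal : ENNReal)⁻¹)]
    · rw [ENNReal.toReal_mul, ENNReal.toReal_inv, ENNReal.toReal_natCast, ENNReal.toReal_natCast,
        Nat.cast_sub Fintype.card_pos]
      field_simp
      simp
    rintro k ⟨w, s⟩ hx
    obtain ⟨h1, h2, h3⟩ := hsupp d (k, fun _ _ => none) _ hx
    obtain rfl : s = (k, fun _ _ => none) := h1
    refine hashTest_apply hr d h2 h3 fun u => ?_
    rw [if_neg fun h' => h (hg h').symm]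
    exact uniform_map_decide_eq_false u

end Schema

end EncDB

end

theorem mainTheorem2 (S : EncDB.Schema) (D : S.E) (hD : S.IsDeterministic D) (hS : S.IsStrict D)
    (a : ℕ) (ha : 1 ≤ a) (hSa : S.ArityLE a) (ι : Type) :
    -- only equality among the values is leaked
    (∀ d₀ d₁ : ι → S.domE D, (∀ i j, d₀ i = d₀ j ↔ d₁ i = d₁ j) →
      S.Indist a (S.world D d₀) (S.world D d₁)) ∧
    -- everything can be simulated from deterministic encryptions of the values
    (∀ Δ : EncDB.DetEnc (S.domE D), ∃ Sim : (ι → Δ.Cipher) → EncDB.System (S.advI D ι),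
      ∀ (k : Δ.Key) (d : ι → S.domE D),
        S.Indist a (S.world D d) (Sim fun i => Δ.enc k (d i))) ∧
    -- conversely, equality is leaked as soon as there is a path to `boolean` ...
    (Nonempty (S.Walk (.enc D) .boolean) → ∀ i j : ι,
      ∃ (n : ℕ) (A : EncDB.Prog (S.advI D ι) Bool), A.AtMost n ∧
        ∀ d : ι → S.domE D, (d i = d j → A.prob (S.world D d) true = 1) ∧
          (d i ≠ d j → A.prob (S.world D d) false = 1)) ∧
    -- ... or, up to a hash collision, to `hashDom`
    (Nonempty (S.Walk (.enc D) .hashDom) → ∀ i j : ι,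
      ∃ (n : ℕ) (A : EncDB.Prog (S.advI D ι) Bool), A.AtMost n ∧
        ∀ d : ι → S.domE D, (d i = d j → A.prob (S.world D d) true = 1) ∧
          (d i ≠ d j → A.prob (S.world D d) false = 1 - 1 / (Fintype.card S.HashVal : ℝ))) := by
  refine ⟨fun d₀ d₁ h => EncDB.Schema.indist_of_eq_iff hD hS ha hSa h,
    EncDB.Schema.exists_simulator hD hS ha hSa ι,
    fun h i j => EncDB.Schema.exists_equality_test hD h i j,
    fun h i j => EncDB.Schema.exists_hash_test hD h i j⟩
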